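/- Let $M,N\ge 1$ be integers, let $\lambda_S,\lambda_R,\mu\ge 0$, and let $\nu$ be a Borel probability measure on $[-\pi,\pi]$ (that is, on the circle) such that $$\int_{-\pi}^{\pi}\nu(d\theta)\,\sin\theta\cos\theta=0 .$$ Write points of $\mathbb R^{M+N}$ as $\mathbf x=(\mathbf v,\mathbf w)$ with $\mathbf v\in\mathbb R^M$ (system) and $\mathbf w\in\mathbb R^N$ (reservoir). For $1\le i<j\le M+N$ let $r_{ij}(\theta)^{-1}\mathbf x$ be the vector obtained from $\mathbf x$ by replacing $x_i$ with $x_i\cos\theta-x_j\sin\theta$ and $x_j$ with $x_i\sin\theta+x_j\cos\theta$, and let $R_{ij}$ be the bounded operator on $L^1(\mathbb R^{M+N})$ $$(R_{ij}F)(\mathbf x)=\int_{-\pi}^{\pi}F\big(r_{ij}(\theta)^{-1}\mathbf x\big)\,\nu(d\theta).$$ Let $$\mathcal L=\frac{\lambda_S}{M-1}\sum_{1\le i<j\le M}(R_{ij}-I)+\frac{\lambda_R}{N-1}\sum_{M<i<j\le M+N}(R_{ij}-I)+\frac{\mu}{N}\sum_{i=1}^{M}\sum_{j=M+1}^{M+N}(R_{ij}-I),$$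 where the first sum is absent if $M=1$ and the second if $N=1$. Let $f_0$ be a probability density on $\mathbb R^M$ with respect to Lebesgue measure, let $F_0(\mathbf v,\mathbf w)=f_0(\mathbf v)e^{-\pi|\mathbf w|^2}$, and for $t\ge 0$ let $$f(\mathbf v,t)=\int_{\mathbb R^N}\big[e^{t\mathcal L}F_0\big](\mathbf v,\mathbf w)\,d\mathbf w$$ be the marginal on the system of the solution of $\partial_tF=\mathcal LF$, $F(0)=F_0$. For a probability density $f$ on $\mathbb R^M$ let $$\widetilde S(f)=\int_{\mathbb R^M}f(\mathbf v)\log\frac{f(\mathbf v)}{e^{-\pi|\mathbf v|^2}}\,d\mathbf v\in[0,+\infty]$$ be its entropy relative to the Maxwellian. Then for every $t\ge 0$ $$\widetilde S(f(\cdot,t))\le\left[\frac{M}{N+M}+\frac{N}{N+M}\,e^{-t\mu_\nu(N+M)/N}\right]\widetilde S(f_0),\qquad \mu_\nu=\mu\int_{-\pi}^{\pi}\nu(d\theta)\,\sin^2\theta .$$ -/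

import Mathlib

open MeasureTheory

noncomputable section

namespace Kac

section Collision

variable {ι : Type*} [Fintype ι] [DecidableEq ι]

/-- The rotation `r_{ij}(θ)⁻¹` of the velocities: it sends `x` to the vector whose `i`-th coordinate
is `x i cos θ - x j sin θ`, whose `j`-th coordinate is `x i sin θ + x j cos θ`, and whose other
coordinates are those of `x`. -/
def rotInv (i j : ι) (θ : ℝ) (x : ι → ℝ) : ι → ℝ := fun k =>
  if k = i then x i * Real.cos θ - x j * Real.sin θ
  else if k = j then x i * Real.sin θ + x j * Real.cos θ
  else x k

lemma sum_sq_rotInv {i j : ι} (hij : i ≠ j) (θ : ℝ) (x : ι → ℝ) :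
    ∑ k, rotInv i j θ x k ^ 2 = ∑ k, x k ^ 2 := by
  have h : ∑ k ∈ ({i, j} : Finset ι), (rotInv i j θ x k ^ 2 - x k ^ 2)
      = ∑ k, (rotInv i j θ x k ^ 2 - x k ^ 2) := by
    refine Finset.sum_subset (Finset.subset_univ _) fun k _ hk => ?_
    simp only [Finset.mem_insert, Finset.mem_singleton, not_or] at hk
    simp [rotInv, hk.1, hk.2]
  rw [Finset.sum_pair hij, Finset.sum_sub_distrib] at h
  simp only [rotInv, if_true, hij.symm, if_false] at h
  have := Real.sin_sq_add_cos_sq θ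
  rw [← sub_eq_zero, ← Finset.sum_sub_distrib]
  simp only [Finset.sum_sub_distrib, rotInv]
  rw [← h]
  linear_combination (x i ^ 2 + x j ^ 2) * this

/-- The rotation as a linear map of Euclidean space. -/
def rotInvLin (i j : ι) (θ : ℝ) : EuclideanSpace ℝ ι →ₗ[ℝ] EuclideanSpace ℝ ι where
  toFun x := WithLp.toLp 2 (rotInv i j θ x.ofLp)
  map_add' x y := by
    ext k
    simp only [rotInv, PiLp.add_apply]
    split_ifs <;> ring
  map_smul' c x := by
    ext k
    simp only [rotInv, PiLp.smul_apply, smul_eq_mul, RingHom.id_apply]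
    split_ifs <;> ring

lemma measurePreserving_rotInv {i j : ι} (hij : i ≠ j) (θ : ℝ) :
    MeasurePreserving (rotInv i j θ) (volume : Measure (ι → ℝ)) volume := by
  let e : EuclideanSpace ℝ ι →ₗᵢ[ℝ] EuclideanSpace ℝ ι :=
    { rotInvLin i j θ with
      norm_map' := fun x => by
        rw [EuclideanSpace.norm_eq, EuclideanSpace.norm_eq]
        congr 1
        simpa [rotInvLin] using sum_sq_rotInv hij θ x.ofLp }
  have h := (e.toLinearIsometryEquiv rfl).measurePreserving
  exact (PiLp.volume_preserving_ofLp ι).comp (h.comp (PiLp.volume_preserving_toLp ι))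

lemma measurable_rotInv {κ : Type*} [DecidableEq κ] (i j : κ) :
    Measurable (Function.uncurry (rotInv i j)) := by
  refine measurable_pi_lambda _ fun k => ?_
  simp only [Function.uncurry, rotInv]
  split_ifs <;> fun_prop

variable (ν : Measure ℝ) [IsProbabilityMeasure ν]

lemma measurePreserving_skew {i j : ι} (hij : i ≠ j) :
    MeasurePreserving (fun p : ℝ × (ι → ℝ) => (p.1, rotInv i j p.1 p.2))
      (ν.prod volume) (ν.prod volume) :=
  (MeasurePreserving.id ν).skew_product (measurable_rotInv i j)
    (Filter.Eventually.of_forall fun θ => (measurePreserving_rotInv hij θ).map_eq)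

lemma measurePreserving_snd_skew {i j : ι} (hij : i ≠ j) :
    MeasurePreserving (fun p : ℝ × (ι → ℝ) => rotInv i j p.1 p.2) (ν.prod volume) volume :=
  measurePreserving_snd.comp (measurePreserving_skew ν hij)

/-- The collision average `(R_{ij} F)(x) = ∫ F(r_{ij}(θ)⁻¹ x) ν(dθ)`. -/
def collisionFun (i j : ι) (F : (ι → ℝ) → ℝ) : (ι → ℝ) → ℝ :=
  fun x => ∫ θ, F (rotInv i j θ x) ∂ν

lemma integrable_skew {i j : ι} (hij : i ≠ j) {F : (ι → ℝ) → ℝ} (hF : Integrable F) :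
    Integrable (fun p : ℝ × (ι → ℝ) => F (rotInv i j p.1 p.2)) (ν.prod volume) :=
  (measurePreserving_snd_skew ν hij).integrable_comp_of_integrable hF

lemma integrable_collisionFun {i j : ι} (hij : i ≠ j) {F : (ι → ℝ) → ℝ} (hF : Integrable F) :
    Integrable (collisionFun ν i j F) :=
  (integrable_skew ν hij hF).integral_prod_right

lemma collisionFun_congr {i j : ι} (hij : i ≠ j) {F G : (ι → ℝ) → ℝ} (h : F =ᵐ[volume] G) :
    collisionFun ν i j F =ᵐ[volume] collisionFun ν i j G := by
  have h1 : ∀ᵐ p ∂((volume : Measure (ι → ℝ)).prod ν),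
      F (rotInv i j p.2 p.1) = G (rotInv i j p.2 p.1) :=
    (Measure.measurePreserving_swap (μ := (volume : Measure (ι → ℝ)))
      (ν := ν)).quasiMeasurePreserving.ae
      ((measurePreserving_snd_skew ν hij).quasiMeasurePreserving.ae h)
  filter_upwards [Measure.ae_ae_of_ae_prod h1] with x hx
  exact integral_congr_ae hx

lemma collisionFun_add {i j : ι} (hij : i ≠ j) {F G : (ι → ℝ) → ℝ}
    (hF : Integrable F) (hG : Integrable G) :
    collisionFun ν i j (F + G) =ᵐ[volume] collisionFun ν i j F + collisionFun ν i j G := by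
  filter_upwards [(integrable_skew ν hij hF).prod_left_ae,
    (integrable_skew ν hij hG).prod_left_ae] with x h1 h2
  exact integral_add h1 h2

lemma integral_abs_collisionFun_le {i j : ι} (hij : i ≠ j) {F : (ι → ℝ) → ℝ}
    (hF : Integrable F) : ∫ x, ‖collisionFun ν i j F x‖ ≤ ∫ x, ‖F x‖ := by
  have h1 := integrable_skew ν hij hF
  calc ∫ x, ‖collisionFun ν i j F x‖
      ≤ ∫ x, ∫ θ, ‖F (rotInv i j θ x)‖ ∂ν :=
        integral_mono (integrable_collisionFun ν hij hF).norm h1.norm.integral_prod_right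
          fun x => norm_integral_le_integral_norm _
    _ = ∫ θ, (∫ x, ‖F (rotInv i j θ x)‖) ∂ν :=
        (integral_integral_swap (f := fun θ x => ‖F (rotInv i j θ x)‖) h1.norm).symm
    _ = ∫ _θ, (∫ x, ‖F x‖) ∂ν := by
        refine integral_congr_ae (Filter.Eventually.of_forall fun θ => ?_)
        have h2 := measurePreserving_rotInv hij θ
        change ∫ x, ‖F (rotInv i j θ x)‖ = ∫ x, ‖F x‖
        conv_rhs => rw [← h2.map_eq]
        rw [integral_map h2.measurable.aemeasurable]
        rw [h2.map_eq]
        exact hF.aestronglyMeasurable.norm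
    _ = ∫ x, ‖F x‖ := by simp

/-- The collision operator `R_{ij}` as a bounded operator on `L¹(ℝ^ι, dx)`. -/
def collision (i j : ι) (hij : i ≠ j) :
    ((ι → ℝ) →₁[volume] ℝ) →L[ℝ] ((ι → ℝ) →₁[volume] ℝ) :=
  LinearMap.mkContinuous
    { toFun := fun F =>
        (integrable_collisionFun ν hij (L1.integrable_coeFn F)).toL1 (collisionFun ν i j F)
      map_add' := fun F G => by
        rw [← Integrable.toL1_add, Integrable.toL1_eq_toL1_iff]
        exact (collisionFun_congr ν hij (Lp.coeFn_add F G)).trans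
          (collisionFun_add ν hij (L1.integrable_coeFn F) (L1.integrable_coeFn G))
      map_smul' := fun c F => by
        rw [RingHom.id_apply, ← Integrable.toL1_smul, Integrable.toL1_eq_toL1_iff]
        refine (collisionFun_congr ν hij (Lp.coeFn_smul c F)).trans
          (Filter.Eventually.of_forall fun x => ?_)
        simp only [collisionFun, Pi.smul_apply]
        exact integral_smul c _ }
    1 fun F => by
      rw [one_mul]
      change ‖(integrable_collisionFun ν hij (L1.integrable_coeFn F)).toL1 _‖ ≤ _
      rw [L1.norm_of_fun_eq_integral_norm, L1.norm_eq_integral_norm]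
      exact integral_abs_collisionFun_le ν hij (L1.integrable_coeFn F)

lemma coeFn_collision (i j : ι) (hij : i ≠ j) (F : (ι → ℝ) →₁[volume] ℝ) :
    collision ν i j hij F =ᵐ[volume] fun x => ∫ θ, F (rotInv i j θ x) ∂ν :=
  Integrable.coeFn_toL1 (integrable_collisionFun ν hij (L1.integrable_coeFn F))

end Collision

/-- The index set of the velocities `(𝐯, 𝐰)`: `Sum.inl` for the `M` particles of the system,
`Sum.inr` for the `N` particles of the reservoir. -/
abbrev Particle (M N : ℕ) : Type := Fin M ⊕ Fin N

/-- `L¹(ℝ^{M+N})` with respect to Lebesgue measure. -/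
abbrev State (M N : ℕ) : Type := (Particle M N → ℝ) →₁[volume] ℝ

/-- The generator of the master equation on `L¹(ℝ^{M+N})`,
`L = λ_S/(M-1) ∑_{i<j in system} (R_{ij} - I) + λ_R/(N-1) ∑_{i<j in reservoir} (R_{ij} - I)
  + μ/N ∑_{i in system, j in reservoir} (R_{ij} - I)`.
For `M = 1` (or `N = 1`) the first (or second) sum is empty. -/
def generator (M N : ℕ) (lamS lamR mu : ℝ) (ν : Measure ℝ) [IsProbabilityMeasure ν] :
    State M N →L[ℝ] State M N :=
  (lamS / ((M : ℝ) - 1)) • ∑ p : {p : Fin M × Fin M // p.1 < p.2},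
      (collision ν (Sum.inl p.1.1 : Particle M N) (Sum.inl p.1.2)
        (fun h => p.2.ne (Sum.inl.inj h)) - ContinuousLinearMap.id ℝ (State M N))
  + (lamR / ((N : ℝ) - 1)) • ∑ p : {p : Fin N × Fin N // p.1 < p.2},
      (collision ν (Sum.inr p.1.1 : Particle M N) (Sum.inr p.1.2)
        (fun h => p.2.ne (Sum.inr.inj h)) - ContinuousLinearMap.id ℝ (State M N))
  + (mu / (N : ℝ)) • ∑ i : Fin M, ∑ j : Fin N,
      (collision ν (Sum.inl i : Particle M N) (Sum.inr j) Sum.inl_ne_inr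
        - ContinuousLinearMap.id ℝ (State M N))

/-- The Kac evolution `e^{tL}` on `L¹(ℝ^{M+N})`. -/
def evolution (M N : ℕ) (lamS lamR mu : ℝ) (ν : Measure ℝ) [IsProbabilityMeasure ν] (t : ℝ) :
    State M N →L[ℝ] State M N :=
  NormedSpace.exp (t • generator M N lamS lamR mu ν)

/-- The Maxwellian `e^{-π|𝐱|²}` on `ℝ^n`, with `|𝐱|` the Euclidean length. -/
def maxwellian {n : ℕ} (x : Fin n → ℝ) : ℝ := Real.exp (-Real.pi * ∑ k, x k ^ 2)

lemma integrable_maxwellian (n : ℕ) : Integrable (maxwellian (n := n)) := by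
  have h : (maxwellian (n := n)) = fun x => ∏ k, Real.exp (-Real.pi * x k ^ 2) := by
    funext x
    rw [maxwellian, Finset.mul_sum, Real.exp_sum]
  rw [h]
  exact Integrable.fintype_prod (f := fun (_ : Fin n) (y : ℝ) => Real.exp (-Real.pi * y ^ 2))
    fun _ => integrable_exp_neg_mul_sq Real.pi_pos

/-- `F₀(𝐯, 𝐰) = f₀(𝐯) e^{-π|𝐰|²}`. -/
def initialFun {M N : ℕ} (f₀ : (Fin M → ℝ) → ℝ) (x : Particle M N → ℝ) : ℝ :=
  f₀ (fun i => x (Sum.inl i)) * maxwellian (fun j => x (Sum.inr j))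

lemma integrable_initialFun {M : ℕ} (N : ℕ) {f₀ : (Fin M → ℝ) → ℝ} (hf : Integrable f₀) :
    Integrable (initialFun f₀ : (Particle M N → ℝ) → ℝ) :=
  (volume_measurePreserving_sumPiEquivProdPi
    (fun _ : Particle M N => ℝ)).integrable_comp_of_integrable
      (hf.mul_prod (integrable_maxwellian N))

/-- The initial state `F₀` as an element of `L¹(ℝ^{M+N})`. -/
def initialState {M : ℕ} (N : ℕ) (f₀ : (Fin M → ℝ) → ℝ) (hf : Integrable f₀) : State M N :=
  (integrable_initialFun N hf).toL1 (initialFun f₀)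

/-- The marginal on the system, `𝐯 ↦ ∫ F(𝐯, 𝐰) d𝐰`. -/
def marginal {M N : ℕ} (F : State M N) : (Fin M → ℝ) → ℝ :=
  fun v => ∫ w : Fin N → ℝ, F (Sum.elim v w)

/-- The entropy of `f` relative to the Maxwellian, `∫ f log (f / e^{-π|𝐯|²}) d𝐯`, as an extended
real number. For a probability density `f` the negative part of the integrand is always
integrable, so that the value is `+∞` when the integrand is not integrable. -/
def relEntropy {M : ℕ} (f : (Fin M → ℝ) → ℝ) : EReal :=
  open Classical in
  if Integrable (fun v => f v * Real.log (f v / maxwellian v)) then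
    ((∫ v, f v * Real.log (f v / maxwellian v) : ℝ) : EReal)
  else ⊤

end Kac

end

/-! Write a density on the system as the Maxwellian γ times a relative density h; for a probability
density the relative entropy is ∫ `klFun`(h) dγ. Suppose K F(x) = E[F(R x)] with R a random
orthogonal matrix, and let A and B be its system-system and system-reservoir blocks. Because the
Gaussian is invariant under R, the system marginal of K F₀ has relative density T h(v) = E ∫ h(A v +
B w) γ(dw) (`marginal_average_ae_eq`). The heart of the proof is that T contracts entropy by the
factor a as soon as E[A Aᵀ] = a I.

To see this, let P_φ h(x) = ∫ h(x cos φ + z sin φ) γ(dz), which runs from h at φ = 0 to the mean of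
h at φ = π/2. Gaussian integration by parts gives the entropy of P_φ h the derivative -(cos φ sin φ
/ 2π) ∑ₖ ∫ (P_φ gₖ)² / P_φ h dγ, with g the gradient of h (`IsRegular.hasDerivAt_entropyFlow`). The
operator T commutes with P_φ, and the gradient of T h is the average of Aᵀ g. Convexity of x²/y and
Gaussian invariance therefore bound the sum for T h by the average of |Aᵀ P_φ g|² / P_φ h, which
only sees E[A Aᵀ] and equals a times the sum for h (`IsRegular.dissipation_systemAverage_le`).
Integration over φ yields `IsRegular.entropy_systemAverage_le`.

The factor a comes from the diagonal matrix D of energy excesses, which is the projection onto the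
system minus M/(N+M) times the identity. If E[R D Rᵀ] = q D, then a = M/(N+M) + N/(N+M) q. For small
δ the operator 1 + δL is an average over single collisions, with the remaining weight on the
identity; the vanishing of ∫ sin θ cos θ ν(dθ) removes the off-diagonal terms, and D is an
eigenvector of the mean energy exchange, so q = 1 - δκ with κ = μ_ν(N+M)/N. The factors q multiply
under composition (`IsRotationAverage.mul`). Hence (1 + tL/n)ⁿ, which tends to exp(tL), has q = (1 -
tκ/n)ⁿ, which tends to exp(-tκ).

The differentiation requires h bounded, bounded away from 0 and with bounded gradient. A density of
finite entropy is approximated by such functions in L¹ with arbitrarily small increase of entropy,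
and lower semicontinuity of the entropy carries the bound to the limit. -/

open MeasureTheory

noncomputable section

namespace Kac

/-! ### Gaussian measure: orthogonal invariance and integration by parts. -/

section Gaussian

variable {ι κ : Type*} [Fintype ι] [Fintype κ]

/-- The Maxwellian density `e^{-π|x|²}` on `ℝ^ι`. -/
def gaussDensity (x : ι → ℝ) : ℝ := Real.exp (-Real.pi * ∑ k, x k ^ 2)

lemma gaussDensity_pos (x : ι → ℝ) : 0 < gaussDensity x := Real.exp_pos _

@[fun_prop]
lemma continuous_gaussDensity : Continuous (gaussDensity (ι := ι)) := by
  unfold gaussDensity; fun_prop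

lemma gaussDensity_eq_prod (x : ι → ℝ) :
    gaussDensity x = ∏ k, Real.exp (-Real.pi * x k ^ 2) := by
  rw [gaussDensity, Finset.mul_sum, Real.exp_sum]

lemma gaussDensity_elim (v : ι → ℝ) (w : κ → ℝ) :
    gaussDensity (Sum.elim v w) = gaussDensity v * gaussDensity w := by
  simp [gaussDensity, Fintype.sum_sum_type, mul_add, Real.exp_add]

lemma integrable_gaussDensity : Integrable (gaussDensity (ι := ι)) := by
  have := Integrable.fintype_prod (ι := ι) (μ := fun _ => volume)
    (f := fun (_ : ι) (y : ℝ) => Real.exp (-Real.pi * y ^ 2))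
    fun _ => integrable_exp_neg_mul_sq Real.pi_pos
  refine this.congr (Filter.Eventually.of_forall fun x => (gaussDensity_eq_prod x).symm)

lemma integral_gaussDensity : ∫ x : ι → ℝ, gaussDensity x = 1 := by
  simp only [gaussDensity_eq_prod]
  have := integral_fintype_prod_eq_prod (𝕜 := ℝ) (μ := fun _ : ι => (volume : Measure ℝ))
    (fun (_ : ι) (y : ℝ) => Real.exp (-Real.pi * y ^ 2))
  rw [← volume_pi] at this
  have h1 : ∫ y : ℝ, Real.exp (-Real.pi * y ^ 2) = 1 := by
    rw [integral_gaussian, div_self Real.pi_ne_zero, Real.sqrt_one]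
  rw [this]
  simp only [h1, Finset.prod_const_one]

variable (ι) in
/-- The Gaussian probability measure `e^{-π|x|²} dx` on `ℝ^ι`. -/
def gauss : Measure (ι → ℝ) :=
  volume.withDensity fun x => ENNReal.ofReal (gaussDensity x)

instance : IsProbabilityMeasure (gauss ι) where
  measure_univ := by
    rw [gauss, withDensity_apply _ MeasurableSet.univ, Measure.restrict_univ,
      ← ofReal_integral_eq_lintegral_ofReal integrable_gaussDensity
        (Filter.Eventually.of_forall fun x => (gaussDensity_pos x).le), integral_gaussDensity,
      ENNReal.ofReal_one]

lemma gauss_absolutelyContinuous : gauss ι ≪ volume := withDensity_absolutelyContinuous _ _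

lemma volume_absolutelyContinuous_gauss : (volume : Measure (ι → ℝ)) ≪ gauss ι :=
  withDensity_absolutelyContinuous' (by fun_prop)
    (Filter.Eventually.of_forall fun x => by simpa using gaussDensity_pos x)

lemma integral_gauss (f : (ι → ℝ) → ℝ) :
    ∫ x, f x ∂gauss ι = ∫ x, gaussDensity x * f x := by
  rw [gauss, integral_withDensity_eq_integral_toReal_smul (by fun_prop)
    (Filter.Eventually.of_forall fun x => ENNReal.ofReal_lt_top)]
  simp [ENNReal.toReal_ofReal (gaussDensity_pos _).le]

lemma integrable_gauss_iff (f : (ι → ℝ) → ℝ) :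
    Integrable f (gauss ι) ↔ Integrable fun x => gaussDensity x * f x := by
  rw [gauss, integrable_withDensity_iff_integrable_smul' (by fun_prop)
    (Filter.Eventually.of_forall fun x => ENNReal.ofReal_lt_top)]
  simp [ENNReal.toReal_ofReal (gaussDensity_pos _).le]

/-- The space `ι → ℝ` carries the sup norm, so the map is transported to `EuclideanSpace`, where
preserving the sum of squares makes it a linear isometry. -/
lemma measurePreserving_volume_of_sum_sq (L : (ι → ℝ) →ₗ[ℝ] (ι → ℝ))
    (hL : ∀ x, ∑ k, L x k ^ 2 = ∑ k, x k ^ 2) : MeasurePreserving L volume volume := by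
  let e : EuclideanSpace ℝ ι →ₗᵢ[ℝ] EuclideanSpace ℝ ι :=
    { (WithLp.linearEquiv 2 ℝ (ι → ℝ)).symm.toLinearMap ∘ₗ L ∘ₗ
        (WithLp.linearEquiv 2 ℝ (ι → ℝ)).toLinearMap with
      norm_map' := fun x => by
        rw [EuclideanSpace.norm_eq, EuclideanSpace.norm_eq]
        congr 1
        simpa using hL x.ofLp }
  have h := (e.toLinearIsometryEquiv rfl).measurePreserving
  exact (PiLp.volume_preserving_ofLp ι).comp (h.comp (PiLp.volume_preserving_toLp ι))

lemma measurePreserving_gauss_of_sum_sq (L : (ι → ℝ) →ₗ[ℝ] (ι → ℝ))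
    (hL : ∀ x, ∑ k, L x k ^ 2 = ∑ k, x k ^ 2) : MeasurePreserving L (gauss ι) (gauss ι) := by
  have hv := measurePreserving_volume_of_sum_sq L hL
  refine ⟨hv.measurable, ?_⟩
  ext s hs
  rw [Measure.map_apply hv.measurable hs, gauss, withDensity_apply _ hs,
    withDensity_apply _ (hv.measurable hs), ← hv.setLIntegral_comp_preimage hs (by fun_prop)]
  simp [gaussDensity, hL]

lemma measurePreserving_sumElim :
    MeasurePreserving (fun p : (ι → ℝ) × (κ → ℝ) => Sum.elim p.1 p.2)
      ((gauss ι).prod (gauss κ)) (gauss (ι ⊕ κ)) := by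
  have hv := (volume_measurePreserving_sumPiEquivProdPi_symm (fun _ : ι ⊕ κ => ℝ))
  have hm : (fun p : (ι → ℝ) × (κ → ℝ) => (Sum.elim p.1 p.2 : ι ⊕ κ → ℝ))
      = (MeasurableEquiv.sumPiEquivProdPi (fun _ : ι ⊕ κ => ℝ)).symm := by
    funext p k; cases k <;> rfl
  rw [← hm] at hv
  refine ⟨hv.measurable, ?_⟩
  ext s hs
  rw [Measure.map_apply hv.measurable hs, gauss, gauss, gauss,
    prod_withDensity (by fun_prop) (by fun_prop), withDensity_apply _ hs,
    withDensity_apply _ (hv.measurable hs), ← hv.setLIntegral_comp_preimage hs (by fun_prop)]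
  simp [gaussDensity_elim, ENNReal.ofReal_mul (gaussDensity_pos _).le, Measure.volume_eq_prod]

lemma measurePreserving_sumPi :
    MeasurePreserving (fun x : ι ⊕ κ → ℝ => (fun i => x (Sum.inl i), fun j => x (Sum.inr j)))
      (gauss (ι ⊕ κ)) ((gauss ι).prod (gauss κ)) := by
  have h := measurePreserving_sumElim (ι := ι) (κ := κ)
  have hm : Measurable (fun x : ι ⊕ κ → ℝ =>
      ((fun i => x (Sum.inl i), fun j => x (Sum.inr j)) : (ι → ℝ) × (κ → ℝ))) := by fun_prop
  refine ⟨hm, ?_⟩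
  rw [← h.map_eq, Measure.map_map hm h.measurable]
  exact Measure.map_id

/-- The law of `(x cos φ + z sin φ, -x sin φ + z cos φ)` for independent Gaussians `x`, `z`. -/
lemma measurePreserving_rotate (c s : ℝ) (h : c ^ 2 + s ^ 2 = 1) :
    MeasurePreserving
      (fun p : (ι → ℝ) × (ι → ℝ) => (c • p.1 + s • p.2, (-s) • p.1 + c • p.2))
      ((gauss ι).prod (gauss ι)) ((gauss ι).prod (gauss ι)) := by
  -- A pair of vectors is read as one vector indexed by `ι ⊕ ι`; the map is then a single orthogonal
  -- transformation.
  let L : (ι ⊕ ι → ℝ) →ₗ[ℝ] (ι ⊕ ι → ℝ) :=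
    { toFun := fun x => Sum.elim (fun i => c * x (Sum.inl i) + s * x (Sum.inr i))
        (fun i => -s * x (Sum.inl i) + c * x (Sum.inr i))
      map_add' := fun x y => by
        ext k; cases k <;> simp <;> ring
      map_smul' := fun a x => by
        ext k; cases k <;> simp <;> ring }
  have hL : ∀ x, ∑ k, L x k ^ 2 = ∑ k, x k ^ 2 := fun x => by
    simp only [L, LinearMap.coe_mk, AddHom.coe_mk, Fintype.sum_sum_type, Sum.elim_inl,
      Sum.elim_inr, ← Finset.sum_add_distrib]
    refine Finset.sum_congr rfl fun i _ => ?_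
    linear_combination (x (Sum.inl i) ^ 2 + x (Sum.inr i) ^ 2) * h
  exact (measurePreserving_sumPi.comp (measurePreserving_gauss_of_sum_sq L hL)).comp
    measurePreserving_sumElim

lemma measurePreserving_combine (c s : ℝ) (h : c ^ 2 + s ^ 2 = 1) :
    MeasurePreserving (fun p : (ι → ℝ) × (ι → ℝ) => c • p.1 + s • p.2)
      ((gauss ι).prod (gauss ι)) (gauss ι) :=
  measurePreserving_fst.comp (measurePreserving_rotate c s h)

lemma integrable_coord (k : ι) : Integrable (fun z : ι → ℝ => z k) (gauss ι) := by
  classical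
  rw [integrable_gauss_iff]
  have h := Integrable.fintype_prod (ι := ι) (μ := fun _ => volume)
    (f := fun (i : ι) (y : ℝ) => (if i = k then y else 1) * Real.exp (-Real.pi * y ^ 2))
    fun i => by
      by_cases hi : i = k
      · simpa [hi] using integrable_mul_exp_neg_mul_sq Real.pi_pos
      · simpa [hi] using integrable_exp_neg_mul_sq Real.pi_pos
  refine h.congr (Filter.Eventually.of_forall fun x => ?_)
  simp only [Finset.prod_mul_distrib, gaussDensity_eq_prod]
  simp [mul_comm]

/-- Gaussian integration by parts. -/
lemma integral_coord_mul [DecidableEq ι] (k : ι) {ψ ψ' : (ι → ℝ) → ℝ} {C C' : ℝ}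
    (hψ : ∀ z, HasLineDerivAt ℝ ψ (ψ' z) z (Pi.single k 1))
    (hm : AEStronglyMeasurable ψ (gauss ι)) (hm' : AEStronglyMeasurable ψ' (gauss ι))
    (hb : ∀ z, |ψ z| ≤ C) (hb' : ∀ z, |ψ' z| ≤ C') :
    ∫ z, z k * ψ z ∂gauss ι = (2 * Real.pi)⁻¹ * ∫ z, ψ' z ∂gauss ι := by
  -- The density satisfies ∂ₖγ = -2π zₖ γ, which is the source of the constant `(2 * Real.pi)⁻¹`.
  have hg : ∀ z : ι → ℝ, HasLineDerivAt ℝ gaussDensity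
      (-(2 * Real.pi) * (gaussDensity z * z k)) z (Pi.single k 1) := by
    intro z
    have h1 : HasFDerivAt (fun x : ι → ℝ => ∑ j, x j ^ 2)
        (∑ j, (2 * z j) • (ContinuousLinearMap.proj j : (ι → ℝ) →L[ℝ] ℝ)) z := by
      refine HasFDerivAt.fun_sum fun j _ => ?_
      have := (hasFDerivAt_apply (𝕜 := ℝ) j z).pow 2
      simpa using this
    have h2 : HasLineDerivAt ℝ gaussDensity _ z (Pi.single k 1) :=
      ((h1.const_mul (-Real.pi)).exp).hasLineDerivAt (Pi.single k 1)
    refine h2.congr_deriv ?_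
    simp only [gaussDensity, FunLike.coe_smul, FunLike.coe_sum, ContinuousLinearMap.proj_apply, Pi.smul_apply, Finset.sum_apply, Pi.single_apply,
      smul_eq_mul, mul_ite, mul_one, mul_zero, Finset.sum_ite_eq', Finset.mem_univ, if_true]
    ring
  have i1 : Integrable (fun z => z k * ψ z) (gauss ι) :=
    (integrable_coord k).mul_bdd (c := C) hm (Filter.Eventually.of_forall hb)
  have i2 : Integrable ψ' (gauss ι) :=
    Integrable.of_bound hm' C' (Filter.Eventually.of_forall hb')
  have i3 : Integrable ψ (gauss ι) :=
    Integrable.of_bound hm C (Filter.Eventually.of_forall hb)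
  rw [integrable_gauss_iff] at i1 i2 i3
  have key := integral_bilinear_hasLineDerivAt_right_eq_neg_left_of_integrable
    (μ := (volume : Measure (ι → ℝ))) (B := ContinuousLinearMap.mul ℝ ℝ)
    (f := gaussDensity) (f' := fun z : ι → ℝ => -(2 * Real.pi) * (gaussDensity z * z k))
    (g := ψ) (g' := ψ') (v := Pi.single k 1)
    (by
      refine (i1.const_mul (-(2 * Real.pi))).congr (Filter.Eventually.of_forall fun z => ?_)
      simp; ring)
    (by simpa using i2) (by simpa using i3) (fun z _ => hg z) fun z _ => hψ z
  rw [integral_gauss, integral_gauss]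
  simp only [ContinuousLinearMap.mul_apply'] at key
  rw [key, ← integral_neg, ← integral_const_mul]
  congr 1
  ext z
  have := Real.pi_ne_zero
  field_simp

end Gaussian

/-! ### Regular functions, random affine averages and the Mehler flow. -/

section Flow

lemma integral_comp_measurePreserving {α β : Type*} [MeasurableSpace α] [MeasurableSpace β]
    {μ : Measure α} {ρ : Measure β} {T : α → β} (hT : MeasurePreserving T μ ρ) {g : β → ℝ}
    (hg : AEStronglyMeasurable g ρ) : ∫ x, g (T x) ∂μ = ∫ y, g y ∂ρ := by
  rw [← hT.map_eq] at hg ⊢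
  rw [integral_map hT.measurable.aemeasurable hg]

lemma abs_integral_le_of_forall_le {α : Type*} [MeasurableSpace α] {μ : Measure α}
    [IsProbabilityMeasure μ] {f : α → ℝ} {C : ℝ} (hf : ∀ x, |f x| ≤ C) : |∫ x, f x ∂μ| ≤ C := by
  have := norm_integral_le_of_norm_le_const (μ := μ) (f := f) (C := C)
    (Filter.Eventually.of_forall hf)
  simpa using this

variable {ι : Type*} [Fintype ι]

/-- `h` takes values in `[m, K]`, with `m > 0`, and has the gradient `g`, whose components are
measurable and bounded by `C`. -/
structure IsRegular (h : (ι → ℝ) → ℝ) (g : ι → (ι → ℝ) → ℝ) (m K C : ℝ) : Prop where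
  pos : 0 < m
  lower : ∀ x, m ≤ h x
  upper : ∀ x, h x ≤ K
  hasFDerivAt : ∀ x,
    HasFDerivAt h (∑ k, g k x • (ContinuousLinearMap.proj k : (ι → ℝ) →L[ℝ] ℝ)) x
  measurable_grad : ∀ k, Measurable (g k)
  bound : ∀ k x, |g k x| ≤ C

namespace IsRegular

variable {h : (ι → ℝ) → ℝ} {g : ι → (ι → ℝ) → ℝ} {m K C : ℝ}

lemma continuous (H : IsRegular h g m K C) : Continuous h :=
  continuous_iff_continuousAt.2 fun x => (H.hasFDerivAt x).continuousAt

lemma measurable (H : IsRegular h g m K C) : Measurable h := H.continuous.measurable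

lemma pos_apply (H : IsRegular h g m K C) (x : ι → ℝ) : 0 < h x := H.pos.trans_le (H.lower x)

lemma abs_le (H : IsRegular h g m K C) (x : ι → ℝ) : |h x| ≤ K := by
  rw [abs_of_pos (H.pos_apply x)]; exact H.upper x

lemma abs_log_le (H : IsRegular h g m K C) (x : ι → ℝ) :
    |Real.log (h x)| ≤ |Real.log m| + |Real.log K| := by
  have h1 := Real.log_le_log H.pos (H.lower x)
  have h2 := Real.log_le_log (H.pos_apply x) (H.upper x)
  rw [_root_.abs_le]
  constructor
  · linarith [neg_abs_le (Real.log m), abs_nonneg (Real.log K)]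
  · linarith [le_abs_self (Real.log K), abs_nonneg (Real.log m)]

lemma integrable {Ω : Type*} [MeasurableSpace Ω] {P : Measure Ω} [IsFiniteMeasure P]
    (H : IsRegular h g m K C) {T : Ω → ι → ℝ} (hT : Measurable T) :
    Integrable (fun ω => h (T ω)) P :=
  Integrable.of_bound (H.measurable.comp hT).aestronglyMeasurable K
    (Filter.Eventually.of_forall fun ω => H.abs_le (T ω))

lemma integrable_grad {Ω : Type*} [MeasurableSpace Ω] {P : Measure Ω} [IsFiniteMeasure P]
    (H : IsRegular h g m K C) (k : ι) {T : Ω → ι → ℝ} (hT : Measurable T) :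
    Integrable (fun ω => g k (T ω)) P :=
  Integrable.of_bound ((H.measurable_grad k).comp hT).aestronglyMeasurable C
    (Filter.Eventually.of_forall fun ω => H.bound k (T ω))

/-- The average of a regular function over random affine maps with contractive entries. -/
lemma affineAverage {Ω : Type*} [MeasurableSpace Ω] {P : Measure Ω} [IsProbabilityMeasure P]
    (H : IsRegular h g m K C) {A : Ω → Matrix ι ι ℝ} {b : Ω → ι → ℝ}
    (hA : ∀ k l, Measurable fun ω => A ω k l) (hb : Measurable b)
    (hA1 : ∀ ω k l, |A ω k l| ≤ 1) :
    IsRegular (fun v => ∫ ω, h ((A ω).mulVec v + b ω) ∂P)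
      (fun l v => ∫ ω, ∑ k, A ω k l * g k ((A ω).mulVec v + b ω) ∂P) m K
      (Fintype.card ι * C) := by
  have hT : Measurable fun p : (ι → ℝ) × Ω => (A p.2).mulVec p.1 + b p.2 := by
    refine Measurable.add (measurable_pi_lambda _ fun k => ?_) (hb.comp measurable_snd)
    simp only [Matrix.mulVec, dotProduct]
    refine Finset.measurable_sum _ fun l _ => ?_
    exact ((hA k l).comp measurable_snd).mul ((measurable_pi_apply l).comp measurable_fst)
  have hTv : ∀ v, Measurable fun ω => (A ω).mulVec v + b ω := fun v =>
    hT.comp (measurable_const.prodMk measurable_id)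
  have hgm : ∀ l, Measurable fun p : (ι → ℝ) × Ω =>
      ∑ k, A p.2 k l * g k ((A p.2).mulVec p.1 + b p.2) := fun l =>
    Finset.measurable_sum _ fun k _ =>
      ((hA k l).comp measurable_snd).mul ((H.measurable_grad k).comp hT)
  -- Each of the `card ι` terms is at most C because the matrix entries are at most 1 in modulus.
  -- Only the finiteness of this gradient bound matters later.
  have hgb : ∀ l v ω, |∑ k, A ω k l * g k ((A ω).mulVec v + b ω)| ≤ Fintype.card ι * C := by
    intro l v ω
    refine (Finset.abs_sum_le_sum_abs _ _).trans ?_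
    rw [← nsmul_eq_mul, ← Finset.card_univ, ← Finset.sum_const]
    refine Finset.sum_le_sum fun k _ => ?_
    rw [abs_mul]
    calc _ ≤ 1 * C := mul_le_mul (hA1 ω k l) (H.bound k _) (abs_nonneg _) zero_le_one
      _ = C := one_mul C
  have hgi : ∀ l v, Integrable
      (fun ω => ∑ k, A ω k l * g k ((A ω).mulVec v + b ω)) P := fun l v =>
    Integrable.of_bound ((hgm l).comp (measurable_const.prodMk measurable_id)).aestronglyMeasurable
      _ (Filter.Eventually.of_forall fun ω => hgb l v ω)
  refine ⟨H.pos, fun v => ?_, fun v => ?_, fun v => ?_, fun l => ?_, fun l v => ?_⟩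
  · have := integral_mono (integrable_const m) (H.integrable (P := P) (hTv v)) fun ω => H.lower _
    simpa using this
  · have := integral_mono (H.integrable (P := P) (hTv v)) (integrable_const K) fun ω => H.upper _
    simpa using this
  · have key := hasFDerivAt_integral_of_dominated_of_fderiv_le (𝕜 := ℝ) (μ := P)
      (F := fun v ω => h ((A ω).mulVec v + b ω))
      (F' := fun v ω => ∑ l, (∑ k, A ω k l * g k ((A ω).mulVec v + b ω)) •
        (ContinuousLinearMap.proj l : (ι → ℝ) →L[ℝ] ℝ))
      (x₀ := v) (s := Set.univ)
      (bound := fun _ => ∑ l : ι, (Fintype.card ι * C) *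
        ‖(ContinuousLinearMap.proj l : (ι → ℝ) →L[ℝ] ℝ)‖)
      Filter.univ_mem
      (Filter.Eventually.of_forall fun x => (H.integrable (P := P) (hTv x)).aestronglyMeasurable)
      (H.integrable (hTv v))
      (Finset.aestronglyMeasurable_fun_sum _ fun l _ =>
        (hgi l v).aestronglyMeasurable.smul_const _)
      (Filter.Eventually.of_forall fun ω x _ => by
        refine (norm_sum_le _ _).trans (Finset.sum_le_sum fun l _ => ?_)
        rw [norm_smul]
        exact mul_le_mul_of_nonneg_right (hgb l x ω) (norm_nonneg _))
      (integrable_const _)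
      (Filter.Eventually.of_forall fun ω x _ => by
        have h1 : HasFDerivAt (fun v => (A ω).mulVec v + b ω)
            (LinearMap.toContinuousLinearMap (A ω).mulVecLin) x :=
          ((LinearMap.toContinuousLinearMap (A ω).mulVecLin).hasFDerivAt).add_const _
        -- By the chain rule the gradient is multiplied by the transpose of the matrix.
        refine ((H.hasFDerivAt _).comp x h1).congr_fderiv ?_
        ext y
        simp only [ContinuousLinearMap.comp_apply, FunLike.coe_sum, FunLike.coe_smul,
          Finset.sum_apply, Pi.smul_apply, ContinuousLinearMap.proj_apply, smul_eq_mul,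
          LinearMap.coe_toContinuousLinearMap', Matrix.mulVecLin_apply, Matrix.mulVec, dotProduct,
          Finset.mul_sum, Finset.sum_mul]
        rw [Finset.sum_comm]
        exact Finset.sum_congr rfl fun l _ => Finset.sum_congr rfl fun k _ => by ring)
    refine key.congr_fderiv ?_
    rw [integral_finsetSum _ fun l _ => (hgi l v).smul_const _]
    exact Finset.sum_congr rfl fun l _ => (integral_smul_const _ _)
  · exact ((hgm l).stronglyMeasurable.integral_prod_right (ν := P)).measurable
  · exact abs_integral_le_of_forall_le fun ω => hgb l v ω

end IsRegular

/-- The Ornstein-Uhlenbeck (Mehler) average `x ↦ ∫ g(c x + s z) γ(dz)`. -/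
def mehler (c s : ℝ) (g : (ι → ℝ) → ℝ) (x : ι → ℝ) : ℝ := ∫ z, g (c • x + s • z) ∂gauss ι

lemma measurable_mehler (c s : ℝ) {g : (ι → ℝ) → ℝ} (hg : Measurable g) :
    Measurable (mehler c s g) := by
  have : Measurable fun p : (ι → ℝ) × (ι → ℝ) => g (c • p.1 + s • p.2) := hg.comp (by fun_prop)
  exact (this.stronglyMeasurable.integral_prod_right (ν := gauss ι)).measurable

lemma abs_mehler_le (c s : ℝ) {g : (ι → ℝ) → ℝ} {C : ℝ} (hg : ∀ x, |g x| ≤ C) (x : ι → ℝ) :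
    |mehler c s g x| ≤ C :=
  abs_integral_le_of_forall_le fun z => hg (c • x + s • z)

variable [DecidableEq ι] {h : (ι → ℝ) → ℝ} {g : ι → (ι → ℝ) → ℝ} {m K C : ℝ}

/-- The case of `IsRegular.affineAverage` with matrix c times the identity and Gaussian shift s z.
The gradient commutes with the Mehler average up to the factor c, which reappears in the entropy
production. -/
lemma IsRegular.isRegular_mehler (H : IsRegular h g m K C) {c s : ℝ} (hc : |c| ≤ 1) :
    IsRegular (mehler c s h) (fun k x => c * mehler c s (g k) x) m K (Fintype.card ι * C) := by
  have := H.affineAverage (P := gauss ι) (A := fun _ => c • (1 : Matrix ι ι ℝ))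
    (b := fun z => s • z) (by fun_prop) (by fun_prop) (fun ω k l => by
      by_cases hkl : k = l <;> simp [hkl, hc])
  convert this using 1
  · funext x; simp [mehler, Matrix.smul_mulVec]
  · funext k x
    simp [mehler, Matrix.smul_mulVec, Matrix.one_apply, integral_const_mul]

end Flow

/-! ### Entropy production along the Mehler flow. -/

section Entropy

variable {ι : Type*} [Fintype ι] {h : (ι → ℝ) → ℝ} {g : ι → (ι → ℝ) → ℝ} {m K C : ℝ}

/-- The derivative in the direction of the rotation, `∑ₖ gₖ(c x + s z) (-s xₖ + c zₖ)`. -/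
def angularDeriv (g : ι → (ι → ℝ) → ℝ) (c s : ℝ) (x z : ι → ℝ) : ℝ :=
  ∑ k, g k (c • x + s • z) * (-s * x k + c * z k)

lemma IsRegular.measurable_angularDeriv (H : IsRegular h g m K C) (c s : ℝ) :
    Measurable fun p : (ι → ℝ) × (ι → ℝ) => angularDeriv g c s p.1 p.2 :=
  Finset.measurable_sum _ fun k _ => ((H.measurable_grad k).comp (by fun_prop)).mul (by fun_prop)

/-- The bound does not depend on c and s, so it dominates the derivative for all angles at once, and
it is Gaussian integrable. -/
lemma IsRegular.abs_angularDeriv_le (H : IsRegular h g m K C) {c s : ℝ} (hc : |c| ≤ 1)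
    (hs : |s| ≤ 1) (x z : ι → ℝ) :
    |angularDeriv g c s x z| ≤ ∑ k, C * (|x k| + |z k|) := by
  refine (Finset.abs_sum_le_sum_abs _ _).trans (Finset.sum_le_sum fun k _ => ?_)
  rw [abs_mul]
  refine mul_le_mul (H.bound k _) ((abs_add_le _ _).trans ?_) (abs_nonneg _)
    ((abs_nonneg _).trans (H.bound k x))
  rw [abs_mul, abs_mul, abs_neg]
  exact add_le_add (mul_le_of_le_one_left (abs_nonneg _) hs)
    (mul_le_of_le_one_left (abs_nonneg _) hc)

lemma integrable_sum_abs_coord (C : ℝ) (x : ι → ℝ) :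
    Integrable (fun z : ι → ℝ => ∑ k, C * (|x k| + |z k|)) (gauss ι) :=
  integrable_finsetSum _ fun k _ =>
    ((integrable_const _).add (integrable_coord k).abs).const_mul C

lemma integral_sum_abs_coord (C : ℝ) (x : ι → ℝ) :
    ∫ z : ι → ℝ, ∑ k, C * (|x k| + |z k|) ∂gauss ι
      = ∑ k, C * (|x k| + ∫ z : ι → ℝ, |z k| ∂gauss ι) := by
  have hi : ∀ k ∈ Finset.univ, Integrable (fun z : ι → ℝ => C * (|x k| + |z k|)) (gauss ι) :=
    fun k _ => ((integrable_const _).add (integrable_coord k).abs).const_mul C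
  rw [integral_finsetSum _ hi]
  refine Finset.sum_congr rfl fun k _ => ?_
  rw [integral_const_mul, integral_add (integrable_const _) (integrable_coord k).abs]
  simp

lemma IsRegular.integrable_angularDeriv (H : IsRegular h g m K C) {c s : ℝ} (hc : |c| ≤ 1)
    (hs : |s| ≤ 1) (x : ι → ℝ) : Integrable (angularDeriv g c s x) (gauss ι) :=
  (integrable_sum_abs_coord C x).mono'
    ((H.measurable_angularDeriv c s).comp (measurable_const.prodMk measurable_id)).aestronglyMeasurable
    (Filter.Eventually.of_forall fun z => H.abs_angularDeriv_le hc hs x z)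

lemma IsRegular.integrable_prod_angularDeriv (H : IsRegular h g m K C) {c s : ℝ} (hc : |c| ≤ 1)
    (hs : |s| ≤ 1) : Integrable (fun p : (ι → ℝ) × (ι → ℝ) => angularDeriv g c s p.1 p.2)
      ((gauss ι).prod (gauss ι)) := by
  have : Integrable (fun p : (ι → ℝ) × (ι → ℝ) => ∑ k, C * (|p.1 k| + |p.2 k|))
      ((gauss ι).prod (gauss ι)) :=
    integrable_finsetSum _ fun k _ =>
      ((integrable_coord k).abs.comp_fst _ |>.add ((integrable_coord k).abs.comp_snd _)).const_mul C
  exact this.mono' (H.measurable_angularDeriv c s).aestronglyMeasurable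
    (Filter.Eventually.of_forall fun p => H.abs_angularDeriv_le hc hs p.1 p.2)

/-- Parametrising the flow by an angle instead of a time t with c = exp(-t) keeps both coefficients
smooth up to s = 0 and places the equilibrium at the finite value φ = π/2. -/
lemma IsRegular.hasDerivAt_mehler (H : IsRegular h g m K C) (φ : ℝ) (x : ι → ℝ) :
    HasDerivAt (fun φ => mehler (Real.cos φ) (Real.sin φ) h x)
      (∫ z, angularDeriv g (Real.cos φ) (Real.sin φ) x z ∂gauss ι) φ := by
  refine (hasDerivAt_integral_of_dominated_loc_of_deriv_le (μ := gauss ι) (s := Set.univ)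
    (F := fun φ z => h (Real.cos φ • x + Real.sin φ • z))
    (F' := fun φ z => angularDeriv g (Real.cos φ) (Real.sin φ) x z)
    (bound := fun z => ∑ k, C * (|x k| + |z k|)) Filter.univ_mem
    (Filter.Eventually.of_forall fun φ => (H.integrable (by fun_prop)).aestronglyMeasurable)
    (H.integrable (by fun_prop))
    (H.integrable_angularDeriv (Real.abs_cos_le_one φ) (Real.abs_sin_le_one φ) x
      ).aestronglyMeasurable
    (Filter.Eventually.of_forall fun z φ _ =>
      H.abs_angularDeriv_le (Real.abs_cos_le_one φ) (Real.abs_sin_le_one φ) x z)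
    (integrable_sum_abs_coord C x)
    (Filter.Eventually.of_forall fun z φ _ => ?_)).2
  have h1 : HasDerivAt (fun φ => Real.cos φ • x + Real.sin φ • z)
      ((-Real.sin φ) • x + Real.cos φ • z) φ :=
    ((Real.hasDerivAt_cos φ).smul_const x).add ((Real.hasDerivAt_sin φ).smul_const z)
  refine ((H.hasFDerivAt _).comp_hasDerivAt φ h1).congr_deriv ?_
  simp [angularDeriv]

/-- The entropy `∫ P log P dγ` of the Mehler average `P` at angle `φ`. -/
def entropyFlow (h : (ι → ℝ) → ℝ) (φ : ℝ) : ℝ :=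
  ∫ x, mehler (Real.cos φ) (Real.sin φ) h x *
    Real.log (mehler (Real.cos φ) (Real.sin φ) h x) ∂gauss ι

/-- The weighted Fisher information `∑ₖ ∫ (P gₖ)² / P h dγ`. -/
def dissipation (h : (ι → ℝ) → ℝ) (g : ι → (ι → ℝ) → ℝ) (c s : ℝ) : ℝ :=
  ∑ k, ∫ x, mehler c s (g k) x ^ 2 / mehler c s h x ∂gauss ι

lemma IsRegular.abs_log_add_one_le (H : IsRegular h g m K C) (x : ι → ℝ) :
    |Real.log (h x) + 1| ≤ |Real.log m| + |Real.log K| + 1 :=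
  (abs_add_le _ _).trans (by simpa using H.abs_log_le x)

variable [DecidableEq ι]

/-- The derivative log y + 1 of y log y stays bounded because the Mehler average keeps its values in
[m, K]; first absolute moments of the Gaussian then dominate the integrand. -/
lemma IsRegular.hasDerivAt_entropyFlow_aux (H : IsRegular h g m K C) (φ : ℝ) :
    HasDerivAt (entropyFlow h)
      (∫ x, (Real.log (mehler (Real.cos φ) (Real.sin φ) h x) + 1) *
        ∫ z, angularDeriv g (Real.cos φ) (Real.sin φ) x z ∂gauss ι ∂gauss ι) φ := by
  have HP := fun φ => H.isRegular_mehler (c := Real.cos φ) (s := Real.sin φ) (Real.abs_cos_le_one φ)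
  set B := |Real.log m| + |Real.log K| + 1 with hB
  have hB0 : 0 ≤ B := by positivity
  have hm : ∀ φ, Measurable fun x => mehler (Real.cos φ) (Real.sin φ) h x := fun φ =>
    (HP φ).measurable
  have hb : ∀ φ x, |∫ z, angularDeriv g (Real.cos φ) (Real.sin φ) x z ∂gauss ι| ≤
      ∑ k, C * (|x k| + ∫ z : ι → ℝ, |z k| ∂gauss ι) := fun φ x => by
    rw [← integral_sum_abs_coord]
    exact norm_integral_le_of_norm_le (f := angularDeriv g (Real.cos φ) (Real.sin φ) x)
      (integrable_sum_abs_coord C x)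
      (Filter.Eventually.of_forall fun z =>
        H.abs_angularDeriv_le (Real.abs_cos_le_one φ) (Real.abs_sin_le_one φ) x z)
  refine (hasDerivAt_integral_of_dominated_loc_of_deriv_le (μ := gauss ι) (s := Set.univ)
    (F := fun φ x => mehler (Real.cos φ) (Real.sin φ) h x *
      Real.log (mehler (Real.cos φ) (Real.sin φ) h x))
    (F' := fun φ x => (Real.log (mehler (Real.cos φ) (Real.sin φ) h x) + 1) *
        ∫ z, angularDeriv g (Real.cos φ) (Real.sin φ) x z ∂gauss ι)
    (bound := fun x => B * ∑ k, C * (|x k| + ∫ z : ι → ℝ, |z k| ∂gauss ι)) Filter.univ_mem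
    (Filter.Eventually.of_forall fun φ => ((hm φ).mul (hm φ).log).aestronglyMeasurable)
    (Integrable.of_bound ((hm φ).mul (hm φ).log).aestronglyMeasurable
      (K * (|Real.log m| + |Real.log K|)) (Filter.Eventually.of_forall fun x => ?_))
    (((hm φ).log.add_const 1).mul ((H.measurable_angularDeriv _ _).stronglyMeasurable.integral_prod_right
      (ν := gauss ι)).measurable).aestronglyMeasurable
    (Filter.Eventually.of_forall fun x φ _ => ?_)
    ((integrable_finsetSum _ fun k _ =>
      ((integrable_coord k).abs.add (integrable_const _)).const_mul C).const_mul B)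
    (Filter.Eventually.of_forall fun x φ _ => ?_)).2
  · rw [norm_mul]
    exact mul_le_mul ((HP φ).abs_le x) ((HP φ).abs_log_le x) (norm_nonneg _)
      ((abs_nonneg _).trans ((HP φ).abs_le x))
  · rw [norm_mul]
    exact mul_le_mul ((HP φ).abs_log_add_one_le x) (hb φ x) (norm_nonneg _) hB0
  · exact (Real.hasDerivAt_mul_log ((HP φ).pos_apply x).ne').comp φ (H.hasDerivAt_mehler φ x)

/-- Gaussian integration by parts for the entropy production. -/
lemma IsRegular.integral_log_mul_angularDeriv (H : IsRegular h g m K C) {c s : ℝ}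
    (hcs : c ^ 2 + s ^ 2 = 1) :
    ∫ x, (Real.log (mehler c s h x) + 1) * ∫ z, angularDeriv g c s x z ∂gauss ι ∂gauss ι
      = -(c * s / (2 * Real.pi)) * dissipation h g c s := by
  have hc : |c| ≤ 1 := by rw [← sq_le_one_iff_abs_le_one]; nlinarith [sq_nonneg s]
  have hs : |s| ≤ 1 := by rw [← sq_le_one_iff_abs_le_one]; nlinarith [sq_nonneg c]
  have HP := H.isRegular_mehler (c := c) (s := s) hc
  set u := mehler c s h with hu
  set B := |Real.log m| + |Real.log K| + 1 with hB
  have hlm : Measurable fun x => Real.log (u x) + 1 := HP.measurable.log.add_const 1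
  have hlb : ∀ x, |Real.log (u x) + 1| ≤ B := HP.abs_log_add_one_le
  -- the gradient of the logarithm
  set q : ι → (ι → ℝ) → ℝ := fun k x => c * mehler c s (g k) x / u x with hq
  have hqm : ∀ k, Measurable (q k) := fun k => (HP.measurable_grad k).div HP.measurable
  have hqb : ∀ k x, |q k x| ≤ (Fintype.card ι * C) / m := fun k x => by
    rw [hq, abs_div, abs_of_pos (HP.pos_apply x)]
    exact div_le_div₀ ((abs_nonneg _).trans (HP.bound k x)) (HP.bound k x) H.pos (HP.lower x)
  have hline : ∀ k y z, HasLineDerivAt ℝ (fun z => Real.log (u (c • y + (-s) • z)) + 1)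
      (-s * q k (c • y + (-s) • z)) z (Pi.single k 1) := by
    intro k y z
    have h1 : HasFDerivAt (fun z : ι → ℝ => c • y + (-s) • z)
        ((-s) • ContinuousLinearMap.id ℝ (ι → ℝ)) z :=
      ((hasFDerivAt_id z).const_smul (-s)).const_add _
    have h2 := ((HP.hasFDerivAt (c • y + (-s) • z)).log (HP.pos_apply _).ne').comp z h1
    have h3 : HasLineDerivAt ℝ (fun z => Real.log (u (c • y + (-s) • z)) + 1) _ z (Pi.single k 1) :=
      (h2.add_const 1).hasLineDerivAt (Pi.single k 1)
    refine h3.congr_deriv ?_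
    simp [Pi.single_apply, hq]
    exact Or.inl (by ring)
  have hcs' : c ^ 2 + (-s) ^ 2 = 1 := by rw [neg_sq]; exact hcs
  have hrot := measurePreserving_rotate (ι := ι) c (-s) hcs'
  have hback : ∀ y z : ι → ℝ, c • (c • y + (-s) • z) + s • (-(-s) • y + c • z) = y := by
    intro y z
    ext k
    simp only [Pi.add_apply, Pi.smul_apply, smul_eq_mul]
    linear_combination y k * hcs
  have hback2 : ∀ (y z : ι → ℝ) k, -s * (c • y + (-s) • z) k + c * (-(-s) • y + c • z) k = z k := by
    intro y z k
    simp only [Pi.add_apply, Pi.smul_apply, smul_eq_mul]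
    linear_combination z k * hcs
  have hgz : ∀ k, Integrable (fun p : (ι → ℝ) × (ι → ℝ) =>
      g k p.1 * (p.2 k * (Real.log (u (c • p.1 + (-s) • p.2)) + 1)))
      ((gauss ι).prod (gauss ι)) := fun k => by
    refine Integrable.bdd_mul (c := C) ?_
      ((H.measurable_grad k).comp measurable_fst).aestronglyMeasurable
      (Filter.Eventually.of_forall fun p => H.bound k p.1)
    exact ((integrable_coord k).comp_snd _).mul_bdd (c := B)
      (hlm.comp (by fun_prop)).aestronglyMeasurable (Filter.Eventually.of_forall fun p => hlb _)
  have hla : Integrable (fun p : (ι → ℝ) × (ι → ℝ) =>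
      (Real.log (u p.1) + 1) * angularDeriv g c s p.1 p.2) ((gauss ι).prod (gauss ι)) :=
    (H.integrable_prod_angularDeriv hc hs).bdd_mul (c := B)
      (hlm.comp measurable_fst).aestronglyMeasurable
      (Filter.Eventually.of_forall fun p => hlb p.1)
  have hgq : ∀ k (T : (ι → ℝ) × (ι → ℝ) → (ι → ℝ)) (S : (ι → ℝ) × (ι → ℝ) → (ι → ℝ)),
      Measurable T → Measurable S → Integrable (fun p => g k (T p) * q k (S p))
      ((gauss ι).prod (gauss ι)) := fun k T S hT hS =>
    (H.integrable_grad k hT).mul_bdd (c := (Fintype.card ι * C) / m)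
      ((hqm k).comp hS).aestronglyMeasurable (Filter.Eventually.of_forall fun p => hqb k _)
  calc ∫ x, (Real.log (u x) + 1) * ∫ z, angularDeriv g c s x z ∂gauss ι ∂gauss ι
      = ∫ p : (ι → ℝ) × (ι → ℝ), (Real.log (u p.1) + 1) * angularDeriv g c s p.1 p.2
          ∂(gauss ι).prod (gauss ι) := by
        rw [integral_prod _ hla]
        simp only [integral_const_mul]
    -- The inverse rotation x = c y - s z, z' = s y + c z turns c x + s z' into y and -s x + c z'
    -- into z. The gradient now depends on y alone, and z enters linearly and through the logarithm.
    _ = ∫ p : (ι → ℝ) × (ι → ℝ), ∑ k, g k p.1 * (p.2 k *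
          (Real.log (u (c • p.1 + (-s) • p.2)) + 1)) ∂(gauss ι).prod (gauss ι) := by
        rw [← integral_comp_measurePreserving hrot hla.aestronglyMeasurable]
        refine integral_congr_ae (Filter.Eventually.of_forall fun p => ?_)
        simp only [angularDeriv, hback, hback2, Finset.mul_sum]
        exact Finset.sum_congr rfl fun k _ => by ring
    _ = ∑ k, ∫ y, g k y * ∫ z, z k * (Real.log (u (c • y + (-s) • z)) + 1)
          ∂gauss ι ∂gauss ι := by
        rw [integral_finsetSum _ fun k _ => hgz k]
        refine Finset.sum_congr rfl fun k _ => ?_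
        rw [integral_prod _ (hgz k)]
        simp only [integral_const_mul]
    -- Integration by parts in zₖ with y frozen removes the unbounded factor zₖ and differentiates
    -- only the logarithm.
    _ = ∑ k, ∫ y, g k y * ((2 * Real.pi)⁻¹ * ∫ z, -s * q k (c • y + (-s) • z)
          ∂gauss ι) ∂gauss ι := by
        refine Finset.sum_congr rfl fun k _ => ?_
        congr 1
        ext y
        rw [integral_coord_mul k (hline k y) (hlm.comp (by fun_prop)).aestronglyMeasurable
          (((hqm k).comp (by fun_prop)).const_mul (-s)).aestronglyMeasurable (fun z => hlb _)
          (C' := |-s| * ((Fintype.card ι * C) / m)) (fun z => by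
            rw [abs_mul]; exact mul_le_mul_of_nonneg_left (hqb k _) (abs_nonneg _))]
    _ = ∑ k, -(s / (2 * Real.pi)) * ∫ p : (ι → ℝ) × (ι → ℝ),
          g k p.1 * q k (c • p.1 + (-s) • p.2) ∂(gauss ι).prod (gauss ι) := by
        refine Finset.sum_congr rfl fun k _ => ?_
        rw [integral_prod _ (hgq k _ _ (by fun_prop) (by fun_prop)), ← integral_const_mul]
        congr 1
        ext y
        simp only [integral_const_mul]
        ring
    -- Rotating back puts the logarithmic gradient at the unmixed variable, so that integrating out
    -- z turns g(c x + s z) into its Mehler average.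
    _ = ∑ k, -(s / (2 * Real.pi)) * ∫ p : (ι → ℝ) × (ι → ℝ),
          g k (c • p.1 + s • p.2) * q k p.1 ∂(gauss ι).prod (gauss ι) := by
        refine Finset.sum_congr rfl fun k _ => ?_
        rw [← integral_comp_measurePreserving hrot
          (hgq k (fun p => c • p.1 + s • p.2) _ (by fun_prop) measurable_fst).aestronglyMeasurable]
        simp only [hback]
    _ = ∑ k, -(s / (2 * Real.pi)) * (c * ∫ x, mehler c s (g k) x ^ 2 / u x ∂gauss ι) := by
        refine Finset.sum_congr rfl fun k _ => ?_
        rw [integral_prod _ (hgq k _ _ (by fun_prop) (by fun_prop))]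
        congr 1
        rw [← integral_const_mul]
        congr 1
        ext x
        simp only [integral_mul_const]
        change mehler c s (g k) x * q k x = _
        simp only [hq]
        ring
    _ = _ := by
        rw [dissipation, Finset.mul_sum]
        exact Finset.sum_congr rfl fun k _ => by ring

lemma IsRegular.hasDerivAt_entropyFlow (H : IsRegular h g m K C) (φ : ℝ) :
    HasDerivAt (entropyFlow h) (-(Real.cos φ * Real.sin φ / (2 * Real.pi)) *
      dissipation h g (Real.cos φ) (Real.sin φ)) φ := by
  rw [← H.integral_log_mul_angularDeriv (Real.cos_sq_add_sin_sq φ)]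
  exact H.hasDerivAt_entropyFlow_aux φ

end Entropy

/-! ### Averages over random rotations and the reservoir commute with the flow. -/

section Average

variable {ι κ : Type*} [Fintype ι] [Fintype κ]

/-- Joint convexity of x²/y: integrate the tangent bound x²/y ≥ 2 r x - r² y, with r the ratio of
the two means. -/
lemma sq_integral_div_le {α : Type*} [MeasurableSpace α] {μ : Measure α} {X Y : α → ℝ}
    (hX : Integrable X μ) (hY : Integrable Y μ) (hXY : Integrable (fun a => X a ^ 2 / Y a) μ)
    (hpos : ∀ a, 0 < Y a) (hY0 : 0 < ∫ a, Y a ∂μ) :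
    (∫ a, X a ∂μ) ^ 2 / ∫ a, Y a ∂μ ≤ ∫ a, X a ^ 2 / Y a ∂μ := by
  set r := (∫ a, X a ∂μ) / ∫ a, Y a ∂μ with hr
  have h1 : ∫ a, (2 * r * X a - r ^ 2 * Y a) ∂μ ≤ ∫ a, X a ^ 2 / Y a ∂μ := by
    refine integral_mono ((hX.const_mul _).sub (hY.const_mul _)) hXY fun a => ?_
    have := hpos a
    change 2 * r * X a - r ^ 2 * Y a ≤ X a ^ 2 / Y a
    rw [le_div_iff₀ this]
    nlinarith [sq_nonneg (X a - r * Y a)]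
  rw [integral_sub (hX.const_mul _) (hY.const_mul _), integral_const_mul, integral_const_mul] at h1
  refine le_trans (le_of_eq ?_) h1
  rw [hr]
  field_simp
  ring

/-- The system part of `R (v, w)`. -/
def systemPart (R : Matrix (ι ⊕ κ) (ι ⊕ κ) ℝ) (v : ι → ℝ) (w : κ → ℝ) : ι → ℝ :=
  fun i => R.mulVec (Sum.elim v w) (Sum.inl i)

lemma systemPart_eq (R : Matrix (ι ⊕ κ) (ι ⊕ κ) ℝ) (v : ι → ℝ) (w : κ → ℝ) :
    systemPart R v w = R.toBlocks₁₁.mulVec v + R.toBlocks₁₂.mulVec w := by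
  ext i
  simp [systemPart, Matrix.mulVec, dotProduct, Fintype.sum_sum_type, Matrix.toBlocks₁₁,
    Matrix.toBlocks₁₂]

lemma systemPart_combine (R : Matrix (ι ⊕ κ) (ι ⊕ κ) ℝ) (c s : ℝ) (v z : ι → ℝ) (w w' : κ → ℝ) :
    c • systemPart R v w + s • systemPart R z w'
      = systemPart R (c • v + s • z) (c • w + s • w') := by
  simp only [systemPart_eq, Matrix.mulVec_add, Matrix.mulVec_smul, smul_add]
  abel

lemma measurable_systemPart {Ω : Type*} [MeasurableSpace Ω] {R : Ω → Matrix (ι ⊕ κ) (ι ⊕ κ) ℝ}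
    (hRm : ∀ k l, Measurable fun ω => R ω k l) {α : Type*}
    [MeasurableSpace α] {U : α → Ω} {T : α → (ι → ℝ)} {S : α → (κ → ℝ)} (hU : Measurable U)
    (hT : Measurable T) (hS : Measurable S) :
    Measurable fun a => systemPart (R (U a)) (T a) (S a) := by
  refine measurable_pi_lambda _ fun i => ?_
  simp only [systemPart, Matrix.mulVec, dotProduct, Fintype.sum_sum_type, Sum.elim_inl,
    Sum.elim_inr]
  refine Measurable.add (Finset.measurable_sum _ fun j _ => ?_)
    (Finset.measurable_sum _ fun j _ => ?_)
  · exact ((hRm _ _).comp hU).mul ((measurable_pi_apply j).comp hT)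
  · exact ((hRm _ _).comp hU).mul ((measurable_pi_apply j).comp hS)

lemma measurable_comp_systemPart {Ω : Type*} [MeasurableSpace Ω]
    {R : Ω → Matrix (ι ⊕ κ) (ι ⊕ κ) ℝ} (hRm : ∀ k l, Measurable fun ω => R ω k l)
    {f : Ω → (ι → ℝ) → ℝ} (hf : Measurable (Function.uncurry f)) {α : Type*}
    [MeasurableSpace α] (U : α → Ω) (T : α → (ι → ℝ)) (S : α → (κ → ℝ)) (hU : Measurable U)
    (hT : Measurable T) (hS : Measurable S) :
    Measurable fun a => f (U a) (systemPart (R (U a)) (T a) (S a)) :=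
  hf.comp (hU.prodMk (measurable_systemPart hRm hU hT hS))

lemma sum_sq_mulVec_of_orthogonal {J : Type*} [Fintype J] [DecidableEq J] {R : Matrix J J ℝ}
    (hR : R.transpose * R = 1) (x : J → ℝ) : ∑ k, R.mulVec x k ^ 2 = ∑ k, x k ^ 2 := by
  have h : dotProduct (R.mulVec x) (R.mulVec x) = dotProduct x x := by
    rw [Matrix.dotProduct_mulVec, Matrix.vecMul_mulVec, hR, Matrix.vecMul_one]
  simpa [dotProduct, sq] using h

lemma abs_entry_le_one_of_orthogonal {J : Type*} [Fintype J] [DecidableEq J] {R : Matrix J J ℝ}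
    (hR : R.transpose * R = 1) (k l : J) : |R k l| ≤ 1 := by
  have h : ∑ j, R j l * R j l = 1 := by
    have := congrFun (congrFun hR l) l
    simpa [Matrix.mul_apply] using this
  have h2 : R k l * R k l ≤ 1 := by
    rw [← h]
    exact Finset.single_le_sum (f := fun j => R j l * R j l) (fun j _ => mul_self_nonneg _)
      (Finset.mem_univ k)
  rw [← sq_le_one_iff_abs_le_one, sq]
  exact h2

variable [DecidableEq ι] [DecidableEq κ]

/-- An orthogonal image of a standard Gaussian is standard Gaussian, and so is its system marginal.
The law does not depend on R, which later decouples the random matrix from the point of evaluation.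
-/
lemma measurePreserving_systemPart {R : Matrix (ι ⊕ κ) (ι ⊕ κ) ℝ} (hR : R.transpose * R = 1) :
    MeasurePreserving (fun p : (ι → ℝ) × (κ → ℝ) => systemPart R p.1 p.2)
      ((gauss ι).prod (gauss κ)) (gauss ι) :=
  measurePreserving_fst.comp (measurePreserving_sumPi.comp
    ((measurePreserving_gauss_of_sum_sq R.mulVecLin (sum_sq_mulVec_of_orthogonal hR)).comp
      measurePreserving_sumElim))

lemma integrable_of_bounded {α : Type*} [MeasurableSpace α] {μ : Measure α} [IsFiniteMeasure μ]
    {f : α → ℝ} {C : ℝ} (hf : Measurable f) (hb : ∀ x, |f x| ≤ C) : Integrable f μ :=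
  Integrable.of_bound hf.aestronglyMeasurable C (Filter.Eventually.of_forall hb)

/-- Averaging over the reservoir after a rotation commutes with the Mehler average. -/
lemma integral_systemPart_mehler {R : Matrix (ι ⊕ κ) (ι ⊕ κ) ℝ} (hR : R.transpose * R = 1)
    {c s : ℝ} (hcs : c ^ 2 + s ^ 2 = 1) {f : (ι → ℝ) → ℝ} {C : ℝ} (hf : Measurable f)
    (hb : ∀ x, |f x| ≤ C) (v : ι → ℝ) :
    ∫ z, ∫ w, f (systemPart R (c • v + s • z) w) ∂gauss κ ∂gauss ι
      = ∫ w, mehler c s f (systemPart R v w) ∂gauss κ := by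
  have hfS : Measurable fun q : (ι → ℝ) × (κ → ℝ) => f (systemPart R q.1 q.2) :=
    hf.comp (measurePreserving_systemPart hR).measurable
  have m1 : ∀ w : κ → ℝ, Measurable fun p : (ι → ℝ) × (κ → ℝ) =>
      f (systemPart R (c • v + s • p.1) (c • w + s • p.2)) := fun w =>
    hfS.comp (show Measurable fun p : (ι → ℝ) × (κ → ℝ) =>
      (c • v + s • p.1, c • w + s • p.2) by fun_prop)
  have m2 : ∀ z : ι → ℝ, Measurable fun w : κ → ℝ => f (systemPart R (c • v + s • z) w) := fun z =>
    hfS.comp (show Measurable fun w : κ → ℝ => (c • v + s • z, w) by fun_prop)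
  have m3 : ∀ z : ι → ℝ, Measurable fun p : (κ → ℝ) × (κ → ℝ) =>
      f (systemPart R (c • v + s • z) (c • p.1 + s • p.2)) := fun z =>
    (m2 z).comp (show Measurable fun p : (κ → ℝ) × (κ → ℝ) => c • p.1 + s • p.2 by fun_prop)
  have m4 : Measurable fun q : ((ι → ℝ) × (κ → ℝ)) × (κ → ℝ) =>
      f (systemPart R (c • v + s • q.1.1) (c • q.1.2 + s • q.2)) :=
    hfS.comp (show Measurable fun q : ((ι → ℝ) × (κ → ℝ)) × (κ → ℝ) =>
      (c • v + s • q.1.1, c • q.1.2 + s • q.2) by fun_prop)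
  -- The Gaussian noise of the Mehler average is replaced by the system part of R applied to an
  -- independent Gaussian pair, which has the same law; linearity then merges the two system parts.
  have h1 : ∀ w, mehler c s f (systemPart R v w)
      = ∫ z, ∫ w', f (systemPart R (c • v + s • z) (c • w + s • w')) ∂gauss κ ∂gauss ι := by
    intro w
    rw [mehler, ← integral_comp_measurePreserving (measurePreserving_systemPart hR)
      (g := fun y => f (c • systemPart R v w + s • y))
      (hf.comp (by fun_prop)).aestronglyMeasurable]
    simp only [systemPart_combine]
    exact integral_prod _ (integrable_of_bounded (m1 w) fun _ => hb _)
  -- The reservoir Gaussian has the law of c w + s w' for independent copies, so both sides become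
  -- the same triple integral.
  have h2 : ∀ z, ∫ w, f (systemPart R (c • v + s • z) w) ∂gauss κ
      = ∫ w, ∫ w', f (systemPart R (c • v + s • z) (c • w + s • w')) ∂gauss κ ∂gauss κ := by
    intro z
    rw [← integral_comp_measurePreserving (measurePreserving_combine (ι := κ) c s hcs)
      (g := fun w => f (systemPart R (c • v + s • z) w)) (m2 z).aestronglyMeasurable]
    exact integral_prod _ (integrable_of_bounded (m3 z) fun _ => hb _)
  simp only [h1, h2]
  refine integral_integral_swap (f := fun z w =>
    ∫ w', f (systemPart R (c • v + s • z) (c • w + s • w')) ∂gauss κ) ?_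
  exact integrable_of_bounded (C := C)
    (m4.stronglyMeasurable.integral_prod_right (ν := gauss κ)).measurable
    fun p => abs_integral_le_of_forall_le fun _ => hb _

variable {Ω : Type*} [MeasurableSpace Ω] (P : Measure Ω) [IsProbabilityMeasure P]
  {R : Ω → Matrix (ι ⊕ κ) (ι ⊕ κ) ℝ}

/-- The function may depend on ω because the gradient of an average carries the entries of the
random matrix. -/
lemma integral_average_mehler (hRm : ∀ k l, Measurable fun ω => R ω k l)
    (hR : ∀ ω, (R ω).transpose * R ω = 1) {c s : ℝ} (hcs : c ^ 2 + s ^ 2 = 1)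
    {f : Ω → (ι → ℝ) → ℝ} {C : ℝ} (hf : Measurable (Function.uncurry f))
    (hb : ∀ ω x, |f ω x| ≤ C) (v : ι → ℝ) :
    mehler c s (fun v => ∫ p : Ω × (κ → ℝ), f p.1 (systemPart (R p.1) v p.2) ∂P.prod (gauss κ)) v
      = ∫ p : Ω × (κ → ℝ), mehler c s (f p.1) (systemPart (R p.1) v p.2) ∂P.prod (gauss κ) := by
  have hmm : Measurable fun p : Ω × (κ → ℝ) => mehler c s (f p.1) (systemPart (R p.1) v p.2) := by
    have h1 : Measurable fun q : (Ω × (κ → ℝ)) × (ι → ℝ) =>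
        f q.1.1 (c • systemPart (R q.1.1) v q.1.2 + s • q.2) := by
      refine hf.comp ((measurable_fst.comp measurable_fst).prodMk (Measurable.add ?_ (by fun_prop)))
      exact (measurable_systemPart hRm (by fun_prop) (by fun_prop) (by fun_prop)).const_smul c
    exact (h1.stronglyMeasurable.integral_prod_right (ν := gauss ι)).measurable
  calc mehler c s (fun v => ∫ p : Ω × (κ → ℝ), f p.1 (systemPart (R p.1) v p.2)
          ∂P.prod (gauss κ)) v
      = ∫ z, ∫ ω, ∫ w, f ω (systemPart (R ω) (c • v + s • z) w) ∂gauss κ ∂P ∂gauss ι := by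
        rw [mehler]
        refine integral_congr_ae (Filter.Eventually.of_forall fun z => ?_)
        exact integral_prod _ (integrable_of_bounded
          (measurable_comp_systemPart hRm hf _ _ _ measurable_fst measurable_const measurable_snd) fun _ => hb _ _)
    _ = ∫ ω, ∫ z, ∫ w, f ω (systemPart (R ω) (c • v + s • z) w) ∂gauss κ ∂gauss ι ∂P := by
        refine integral_integral_swap (f := fun z ω =>
          ∫ w, f ω (systemPart (R ω) (c • v + s • z) w) ∂gauss κ) ?_
        refine integrable_of_bounded (C := C) ?_
          fun p => abs_integral_le_of_forall_le fun _ => hb _ _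
        have : Measurable fun q : ((ι → ℝ) × Ω) × (κ → ℝ) =>
          f q.1.2 (systemPart (R q.1.2) (c • v + s • q.1.1) q.2) :=
          measurable_comp_systemPart hRm hf (fun q : ((ι → ℝ) × Ω) × (κ → ℝ) => q.1.2) (fun q => c • v + s • q.1.1)
            (fun q => q.2) (by fun_prop) (by fun_prop) (by fun_prop)
        exact (this.stronglyMeasurable.integral_prod_right (ν := gauss κ)).measurable
    _ = ∫ ω, ∫ w, mehler c s (f ω) (systemPart (R ω) v w) ∂gauss κ ∂P :=
        integral_congr_ae (Filter.Eventually.of_forall fun ω =>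
          integral_systemPart_mehler (hR ω) hcs (hf.comp measurable_prodMk_left) (hb ω) v)
    _ = _ := (integral_prod _ (integrable_of_bounded hmm fun p => abs_mehler_le c s (hb _) _)).symm

/-- After integration over v as well as w, the argument has the Gaussian law for every fixed ω, so
the rotation disappears from the argument of f. -/
lemma integral_integral_systemPart (hRm : ∀ k l, Measurable fun ω => R ω k l)
    (hR : ∀ ω, (R ω).transpose * R ω = 1)
    {f : Ω → (ι → ℝ) → ℝ} {C : ℝ} (hf : Measurable (Function.uncurry f))
    (hb : ∀ ω x, |f ω x| ≤ C) :
    ∫ v, ∫ p : Ω × (κ → ℝ), f p.1 (systemPart (R p.1) v p.2) ∂P.prod (gauss κ) ∂gauss ι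
      = ∫ ω, ∫ y, f ω y ∂gauss ι ∂P := by
  calc ∫ v, ∫ p : Ω × (κ → ℝ), f p.1 (systemPart (R p.1) v p.2) ∂P.prod (gauss κ) ∂gauss ι
      = ∫ v, ∫ ω, ∫ w, f ω (systemPart (R ω) v w) ∂gauss κ ∂P ∂gauss ι := by
        refine integral_congr_ae (Filter.Eventually.of_forall fun z => ?_)
        exact integral_prod _ (integrable_of_bounded
          (measurable_comp_systemPart hRm hf _ _ _ measurable_fst measurable_const measurable_snd) fun _ => hb _ _)
    _ = ∫ ω, ∫ v, ∫ w, f ω (systemPart (R ω) v w) ∂gauss κ ∂gauss ι ∂P := by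
        refine integral_integral_swap (f := fun v ω =>
          ∫ w, f ω (systemPart (R ω) v w) ∂gauss κ) ?_
        refine integrable_of_bounded (C := C) ?_
          fun p => abs_integral_le_of_forall_le fun _ => hb _ _
        have : Measurable fun q : ((ι → ℝ) × Ω) × (κ → ℝ) =>
          f q.1.2 (systemPart (R q.1.2) q.1.1 q.2) :=
          measurable_comp_systemPart hRm hf (fun q : ((ι → ℝ) × Ω) × (κ → ℝ) => q.1.2) (fun q => q.1.1)
            (fun q => q.2) (by fun_prop) (by fun_prop) (by fun_prop)
        exact (this.stronglyMeasurable.integral_prod_right (ν := gauss κ)).measurable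
    _ = _ := by
        refine integral_congr_ae (Filter.Eventually.of_forall fun ω => ?_)
        have h1 : Measurable (f ω) := hf.comp measurable_prodMk_left
        have h2 := integral_comp_measurePreserving (measurePreserving_systemPart (hR ω))
          h1.aestronglyMeasurable
        change _ = ∫ y, f ω y ∂gauss ι
        rw [← h2]
        exact (integral_prod _ (integrable_of_bounded
          (h1.comp (measurePreserving_systemPart (hR ω)).measurable) fun _ => hb _ _)).symm

end Average

/-! ### Entropy contraction when E[A Aᵀ] is a multiple of the identity. -/

section Contraction

variable {ι κ : Type*} [Fintype ι] [Fintype κ]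

/-- The average of `h` over random rotations and the reservoir. -/
def systemAverage {Ω : Type*} [MeasurableSpace Ω] (P : Measure Ω)
    (R : Ω → Matrix (ι ⊕ κ) (ι ⊕ κ) ℝ) (h : (ι → ℝ) → ℝ) (v : ι → ℝ) : ℝ :=
  ∫ p : Ω × (κ → ℝ), h (systemPart (R p.1) v p.2) ∂P.prod (gauss κ)

/-- The gradient of `systemAverage` in terms of the gradient `g` of the averaged function. -/
def systemAverageGrad {Ω : Type*} [MeasurableSpace Ω] (P : Measure Ω)
    (R : Ω → Matrix (ι ⊕ κ) (ι ⊕ κ) ℝ) (g : ι → (ι → ℝ) → ℝ) (l : ι) (v : ι → ℝ) : ℝ :=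
  ∫ p : Ω × (κ → ℝ), ∑ k, R p.1 (Sum.inl k) (Sum.inl l) * g k (systemPart (R p.1) v p.2)
    ∂P.prod (gauss κ)

lemma entropyFlow_zero (h : (ι → ℝ) → ℝ) :
    entropyFlow h 0 = ∫ x, h x * Real.log (h x) ∂gauss ι := by
  simp [entropyFlow, mehler]

lemma entropyFlow_pi_div_two (h : (ι → ℝ) → ℝ) :
    entropyFlow h (Real.pi / 2) =
      (∫ x, h x ∂gauss ι) * Real.log (∫ x, h x ∂gauss ι) := by
  simp [entropyFlow, mehler]

lemma measurable_flip_of_uncurry {α β γ : Type*} [MeasurableSpace α] [MeasurableSpace β]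
    [MeasurableSpace γ] {f : α → β → γ} (hf : Measurable (Function.uncurry f)) :
    Measurable fun q : β × α => f q.2 q.1 :=
  hf.comp (measurable_snd.prodMk measurable_fst)

lemma sum_sq_sum_div (r : ι → ι → ℝ) (x : ι → ℝ) (u : ℝ) :
    ∑ l, (∑ k, r k l * x k) ^ 2 / u
      = ∑ k, ∑ k', (x k * x k' / u) * ∑ l, r k l * r k' l := by
  simp_rw [pow_two, Finset.sum_mul_sum, Finset.sum_div, Finset.mul_sum]
  rw [Finset.sum_comm]
  refine Finset.sum_congr rfl fun k _ => ?_
  rw [Finset.sum_comm]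
  exact Finset.sum_congr rfl fun k' _ => Finset.sum_congr rfl fun l _ => by ring

/-- This is E|Aᵀx|² = xᵀ E[A Aᵀ] x divided by u: the average depends on the random matrix only
through its second moments. -/
lemma sum_integral_sq_div [DecidableEq ι] {Ω : Type*} [MeasurableSpace Ω] (P : Measure Ω)
    [IsFiniteMeasure P] {r : Ω → ι → ι → ℝ} (hrm : ∀ k l, Measurable fun ω => r ω k l)
    (hr : ∀ ω k l, |r ω k l| ≤ 1) {a : ℝ}
    (ha : ∀ k k', ∫ ω, ∑ l, r ω k l * r ω k' l ∂P = if k = k' then a else 0)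
    (x : ι → ℝ) (u : ℝ) :
    ∑ l, ∫ ω, (∑ k, r ω k l * x k) ^ 2 / u ∂P = ∑ k, a * (x k ^ 2 / u) := by
  have hb : ∀ ω k l k' l', |r ω k l * r ω k' l'| ≤ 1 := fun ω k l k' l' => by
    rw [abs_mul]; exact mul_le_one₀ (hr _ _ _) (abs_nonneg _) (hr _ _ _)
  have hi : ∀ k k', Integrable (fun ω => ∑ l, r ω k l * r ω k' l) P := fun k k' =>
    integrable_finsetSum _ fun l _ => integrable_of_bounded ((hrm _ _).mul (hrm _ _))
      fun ω => hb ω k l k' l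
  have hsq : ∀ l ∈ Finset.univ, Integrable (fun ω => (∑ k, r ω k l * x k) ^ 2 / u) P := by
    intro l _
    refine Integrable.div_const ?_ u
    simp only [pow_two, Finset.sum_mul_sum]
    refine integrable_finsetSum _ fun k _ => integrable_finsetSum _ fun k' _ => ?_
    have h1 : Integrable (fun ω => r ω k l * r ω k' l) P :=
      integrable_of_bounded ((hrm _ _).mul (hrm _ _)) fun ω => hb ω k l k' l
    refine (h1.mul_const (x k * x k')).congr (Filter.Eventually.of_forall fun ω => ?_)
    simp only
    ring
  rw [← integral_finsetSum _ hsq]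
  simp only [sum_sq_sum_div]
  rw [integral_finsetSum _ fun k _ => integrable_finsetSum _ fun k' _ => (hi k k').const_mul _]
  refine Finset.sum_congr rfl fun k _ => ?_
  rw [integral_finsetSum _ fun k' _ => (hi k k').const_mul _]
  simp only [integral_const_mul, ha, mul_ite, mul_zero, Finset.sum_ite_eq, Finset.mem_univ,
    if_true]
  ring

variable [DecidableEq ι] [DecidableEq κ] {Ω : Type*} [MeasurableSpace Ω] {P : Measure Ω} [IsProbabilityMeasure P]
  {R : Ω → Matrix (ι ⊕ κ) (ι ⊕ κ) ℝ} {h : (ι → ℝ) → ℝ} {g : ι → (ι → ℝ) → ℝ} {m K C : ℝ}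

/-- For fixed rotation and reservoir velocities the argument is affine in v, with matrix the system
block and shift the reservoir contribution. -/
lemma IsRegular.systemAverage (H : IsRegular h g m K C)
    (hRm : ∀ k l, Measurable fun ω => R ω k l) (hR : ∀ ω, (R ω).transpose * R ω = 1) :
    IsRegular (Kac.systemAverage P R h) (systemAverageGrad P R g) m K (Fintype.card ι * C) := by
  have hb : Measurable fun p : Ω × (κ → ℝ) => (R p.1).toBlocks₁₂.mulVec p.2 := by
    refine measurable_pi_lambda _ fun i => ?_
    simp only [Matrix.mulVec, dotProduct, Matrix.toBlocks₁₂, Matrix.of_apply]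
    exact Finset.measurable_sum _ fun j _ => ((hRm _ _).comp measurable_fst).mul (by fun_prop)
  have := H.affineAverage (P := P.prod (gauss κ)) (A := fun p => (R p.1).toBlocks₁₁)
    (fun k l => (hRm (Sum.inl k) (Sum.inl l)).comp measurable_fst) hb
    (fun p k l => abs_entry_le_one_of_orthogonal (hR p.1) _ _)
  simp only [← systemPart_eq] at this
  exact this

lemma integral_systemAverage (H : IsRegular h g m K C)
    (hRm : ∀ k l, Measurable fun ω => R ω k l) (hR : ∀ ω, (R ω).transpose * R ω = 1) :
    ∫ v, systemAverage P R h v ∂gauss ι = ∫ y, h y ∂gauss ι := by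
  have := integral_integral_systemPart P hRm hR (f := fun _ => h) (C := K)
    (H.measurable.comp measurable_snd) fun _ => H.abs_le
  simpa [systemAverage] using this

/-- Entropy production decreases by the factor `a` if the random system blocks `A` of the
rotations satisfy `E[A Aᵀ] = a`. -/
lemma IsRegular.dissipation_systemAverage_le (H : IsRegular h g m K C)
    (hRm : ∀ k l, Measurable fun ω => R ω k l) (hR : ∀ ω, (R ω).transpose * R ω = 1) {a : ℝ}
    (ha : ∀ k k' : ι, ∫ ω, ∑ l : ι, R ω (Sum.inl k) (Sum.inl l) * R ω (Sum.inl k') (Sum.inl l) ∂P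
      = if k = k' then a else 0) {c s : ℝ} (hcs : c ^ 2 + s ^ 2 = 1) :
    dissipation (Kac.systemAverage P R h) (systemAverageGrad P R g) c s
      ≤ a * dissipation h g c s := by
  have hc : |c| ≤ 1 := by rw [← sq_le_one_iff_abs_le_one]; nlinarith [sq_nonneg s]
  have HP := H.isRegular_mehler (c := c) (s := s) hc
  set u := mehler c s h with hu
  set U : ι → (ι → ℝ) → ℝ := fun k => mehler c s (g k) with hU
  have hUm : ∀ k, Measurable (U k) := fun k => measurable_mehler c s (H.measurable_grad k)
  have hUb : ∀ k x, |U k x| ≤ C := fun k x => abs_mehler_le c s (H.bound k) x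
  have hent : ∀ ω k l, |R ω k l| ≤ 1 := fun ω k l => abs_entry_le_one_of_orthogonal (hR ω) k l
  -- the contracted gradient
  have hsumb : ∀ (f : ι → (ι → ℝ) → ℝ), (∀ k x, |f k x| ≤ C) → ∀ l ω x,
      |∑ k, R ω (Sum.inl k) (Sum.inl l) * f k x| ≤ Fintype.card ι * C := by
    intro f hf l ω x
    refine (Finset.abs_sum_le_sum_abs _ _).trans ?_
    rw [← nsmul_eq_mul, ← Finset.card_univ, ← Finset.sum_const]
    refine Finset.sum_le_sum fun k _ => ?_
    rw [abs_mul]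
    calc _ ≤ 1 * C := mul_le_mul (hent ω _ _) (hf k _) (abs_nonneg _) zero_le_one
      _ = C := one_mul C
  have hsumm : ∀ (f : ι → (ι → ℝ) → ℝ), (∀ k, Measurable (f k)) → ∀ l, Measurable
      (Function.uncurry fun ω x => ∑ k, R ω (Sum.inl k) (Sum.inl l) * f k x) := by
    intro f hf l
    exact Finset.measurable_sum _ fun k _ =>
      ((hRm _ _).comp measurable_fst).mul ((hf k).comp measurable_snd)
  -- X is the transposed system block applied to the Mehler average of the gradient; the summed Z is
  -- its squared length divided by the averaged density.
  set X : ι → Ω → (ι → ℝ) → ℝ := fun l ω x => ∑ k, R ω (Sum.inl k) (Sum.inl l) * U k x with hX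
  have hXm : ∀ l, Measurable (Function.uncurry (X l)) := hsumm U hUm
  have hXb : ∀ l ω x, |X l ω x| ≤ Fintype.card ι * C := hsumb U hUb
  set Z : ι → Ω → (ι → ℝ) → ℝ := fun l ω x => X l ω x ^ 2 / u x with hZ
  have hZm : ∀ l, Measurable (Function.uncurry (Z l)) := fun l =>
    ((hXm l).pow_const 2).div (HP.measurable.comp measurable_snd)
  have hZb : ∀ l ω x, |Z l ω x| ≤ (Fintype.card ι * C) ^ 2 / m := by
    intro l ω x
    rw [hZ, abs_div, abs_of_pos (HP.pos_apply x), abs_pow]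
    exact div_le_div₀ (sq_nonneg _) (pow_le_pow_left₀ (abs_nonneg _) (hXb l ω x) 2) H.pos
      (HP.lower x)
  have e1 : ∀ v, mehler c s (Kac.systemAverage P R h) v
      = ∫ p : Ω × (κ → ℝ), u (systemPart (R p.1) v p.2) ∂P.prod (gauss κ) := fun v =>
    integral_average_mehler P hRm hR hcs (f := fun _ => h) (C := K)
      (H.measurable.comp measurable_snd) (fun _ => H.abs_le) v
  have e2 : ∀ l v, mehler c s (systemAverageGrad P R g l) v
      = ∫ p : Ω × (κ → ℝ), X l p.1 (systemPart (R p.1) v p.2) ∂P.prod (gauss κ) := by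
    intro l v
    have h1 := integral_average_mehler P hRm hR hcs
      (f := fun ω x => ∑ k, R ω (Sum.inl k) (Sum.inl l) * g k x) (C := Fintype.card ι * C)
      (hsumm g H.measurable_grad l) (hsumb g H.bound l) v
    refine h1.trans ?_
    refine integral_congr_ae (Filter.Eventually.of_forall fun p => ?_)
    simp only [mehler, hX, hU]
    rw [integral_finsetSum _ fun k _ => (H.integrable_grad k (by fun_prop)).const_mul _]
    simp only [integral_const_mul]
  have hSm : ∀ v, Measurable fun p : Ω × (κ → ℝ) => systemPart (R p.1) v p.2 := fun v =>
    measurable_systemPart hRm measurable_fst measurable_const measurable_snd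
  have hcomp : ∀ {f : Ω → (ι → ℝ) → ℝ}, Measurable (Function.uncurry f) → ∀ v,
      Measurable fun p : Ω × (κ → ℝ) => f p.1 (systemPart (R p.1) v p.2) := fun hf v =>
    hf.comp (measurable_fst.prodMk (hSm v))
  have HF := H.systemAverage (P := P) (κ := κ) hRm hR
  have HFP := HF.isRegular_mehler (c := c) (s := s) hc
  -- By `sq_integral_div_le` the square of an average over ω and w is bounded by the average of the
  -- squares; the integral over v then separates ω from y.
  have step : ∀ l, ∫ v, mehler c s (systemAverageGrad P R g l) v ^ 2
        / mehler c s (Kac.systemAverage P R h) v ∂gauss ι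
      ≤ ∫ ω, ∫ y, Z l ω y ∂gauss ι ∂P := by
    intro l
    rw [← integral_integral_systemPart P hRm hR (hZm l) (hZb l)]
    have hbase : Measurable fun q : (ι → ℝ) × (Ω × (κ → ℝ)) =>
        Z l q.2.1 (systemPart (R q.2.1) q.1 q.2.2) :=
      measurable_comp_systemPart hRm (hZm l) (fun q : (ι → ℝ) × (Ω × (κ → ℝ)) => q.2.1)
        (fun q => q.1) (fun q => q.2.2) (by fun_prop) (by fun_prop) (by fun_prop)
    have hI : Integrable (fun v => ∫ p : Ω × (κ → ℝ), Z l p.1 (systemPart (R p.1) v p.2)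
        ∂P.prod (gauss κ)) (gauss ι) := integrable_of_bounded
      (hbase.stronglyMeasurable.integral_prod_right (ν := P.prod (gauss κ))).measurable
      fun v => abs_integral_le_of_forall_le fun p => hZb l _ _
    have h0 : 0 ≤ fun v => mehler c s (systemAverageGrad P R g l) v ^ 2
        / mehler c s (Kac.systemAverage P R h) v := fun v =>
      div_nonneg (sq_nonneg _) (HFP.pos_apply v).le
    refine integral_mono_of_nonneg (Filter.Eventually.of_forall h0) hI
      (Filter.Eventually.of_forall fun v => ?_)
    simp only
    have hpos := HFP.pos_apply v
    rw [e1] at hpos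
    rw [e1, e2]
    exact sq_integral_div_le (integrable_of_bounded (hcomp (hXm l) v) fun p => hXb l _ _)
      (HP.integrable (hSm v)) (integrable_of_bounded (hcomp (hZm l) v) fun p => hZb l _ _)
      (fun p => HP.pos_apply _) hpos
  have hUum : ∀ k, Measurable fun y => U k y ^ 2 / u y := fun k =>
    ((hUm k).pow_const 2).div HP.measurable
  have hUu : ∀ k, Integrable (fun y => U k y ^ 2 / u y) (gauss ι) := fun k => by
    refine integrable_of_bounded (C := C ^ 2 / m) (hUum k) fun y => ?_
    rw [abs_div, abs_of_pos (HP.pos_apply y), abs_pow]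
    exact div_le_div₀ (sq_nonneg _) (pow_le_pow_left₀ (abs_nonneg _) (hUb k y) 2) H.pos
      (HP.lower y)
  have hpt : ∀ y, ∑ l, ∫ ω, Z l ω y ∂P = ∑ k, a * (U k y ^ 2 / u y) :=
    fun y => sum_integral_sq_div P (fun k l => hRm (Sum.inl k) (Sum.inl l))
      (fun ω k l => hent ω _ _) ha (fun k => U k y) (u y)
  have hswap : ∀ l, ∫ ω, ∫ y, Z l ω y ∂gauss ι ∂P = ∫ y, ∫ ω, Z l ω y ∂P ∂gauss ι := fun l =>
    integral_integral_swap (f := Z l) (integrable_of_bounded (hZm l) fun p => hZb l p.1 p.2)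
  have hsw : ∀ l, Measurable fun q : (ι → ℝ) × Ω => Z l q.2 q.1 := fun l =>
    measurable_flip_of_uncurry (hZm l)
  have hZi : ∀ l ∈ Finset.univ, Integrable (fun y => ∫ ω, Z l ω y ∂P) (gauss ι) := fun l _ =>
    integrable_of_bounded ((hsw l).stronglyMeasurable.integral_prod_right' (ν := P)).measurable
      fun y => abs_integral_le_of_forall_le fun ω => hZb l ω y
  have hUi : ∀ k ∈ Finset.univ, Integrable (fun y => a * (U k y ^ 2 / u y)) (gauss ι) :=
    fun k _ => (hUu k).const_mul a
  have hsum : ∑ l, ∫ ω, ∫ y, Z l ω y ∂gauss ι ∂P = a * ∑ k, ∫ y, U k y ^ 2 / u y ∂gauss ι := by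
    simp only [hswap]
    rw [← integral_finsetSum _ hZi]
    simp only [hpt]
    rw [integral_finsetSum _ hUi, Finset.mul_sum]
    simp only [integral_const_mul]
  have hle := Finset.sum_le_sum (s := Finset.univ) fun l _ => step l
  rw [hsum] at hle
  exact hle

/-- Contraction of the entropy for regular functions. -/
theorem IsRegular.entropy_systemAverage_le (H : IsRegular h g m K C)
    (hRm : ∀ k l, Measurable fun ω => R ω k l) (hR : ∀ ω, (R ω).transpose * R ω = 1) {a : ℝ}
    (ha : ∀ k k' : ι, ∫ ω, ∑ l : ι, R ω (Sum.inl k) (Sum.inl l) * R ω (Sum.inl k') (Sum.inl l) ∂P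
      = if k = k' then a else 0) :
    ∫ v, Kac.systemAverage P R h v * Real.log (Kac.systemAverage P R h v) ∂gauss ι
        - (∫ y, h y ∂gauss ι) * Real.log (∫ y, h y ∂gauss ι)
      ≤ a * (∫ v, h v * Real.log (h v) ∂gauss ι
        - (∫ y, h y ∂gauss ι) * Real.log (∫ y, h y ∂gauss ι)) := by
  have HF := H.systemAverage (P := P) (κ := κ) hRm hR
  have hd : ∀ φ, HasDerivAt (fun φ => entropyFlow (Kac.systemAverage P R h) φ
      - a * entropyFlow h φ) _ φ := fun φ =>
    (HF.hasDerivAt_entropyFlow φ).sub ((H.hasDerivAt_entropyFlow φ).const_mul a)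
  -- Both entropies have derivative minus the same nonnegative weight times their dissipation, so
  -- the dissipation bound makes this difference nondecreasing. At π/2 both functions have been
  -- replaced by their common mean.
  have hmono : MonotoneOn (fun φ => entropyFlow (Kac.systemAverage P R h) φ
      - a * entropyFlow h φ) (Set.Icc 0 (Real.pi / 2)) := by
    refine monotoneOn_of_deriv_nonneg (convex_Icc _ _)
      (fun φ _ => (hd φ).continuousAt.continuousWithinAt)
      (fun φ _ => (hd φ).differentiableAt.differentiableWithinAt) fun φ hφ => ?_
    rw [(hd φ).deriv]
    rw [interior_Icc] at hφ
    have h1 := H.dissipation_systemAverage_le (P := P) hRm hR ha (Real.cos_sq_add_sin_sq φ)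
    have h2 : 0 ≤ Real.cos φ * Real.sin φ / (2 * Real.pi) :=
      div_nonneg (mul_nonneg (Real.cos_nonneg_of_mem_Icc ⟨by linarith [hφ.1, Real.pi_pos],
        hφ.2.le⟩) (Real.sin_nonneg_of_nonneg_of_le_pi hφ.1.le
          (by linarith [hφ.2, Real.pi_pos]))) (by positivity)
    nlinarith [mul_le_mul_of_nonneg_left h1 h2]
  have h0 : (0 : ℝ) ≤ Real.pi / 2 := by positivity
  have := hmono ⟨le_rfl, h0⟩ ⟨h0, le_rfl⟩ h0
  simp only [entropyFlow_zero, entropyFlow_pi_div_two, integral_systemAverage H hRm hR] at this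
  linarith

end Contraction

/-! ### Matrices of two-particle rotations. -/

section RotationMatrix

variable {J : Type*} [DecidableEq J]

/-- The matrix of the rotation `rotInv i j θ`. -/
def rotMatrix (i j : J) (θ : ℝ) : Matrix J J ℝ := Matrix.of fun k =>
  if k = i then fun m =>
    Real.cos θ * (if m = i then 1 else 0) + -Real.sin θ * (if m = j then 1 else 0)
  else if k = j then fun m =>
    Real.sin θ * (if m = i then 1 else 0) + Real.cos θ * (if m = j then 1 else 0)
  else fun m => if m = k then 1 else 0

lemma measurable_rotMatrix (i j k l : J) : Measurable fun θ => rotMatrix i j θ k l := by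
  simp only [rotMatrix, Matrix.of_apply]
  split_ifs
  all_goals fun_prop

variable [Fintype J]

lemma rotMatrix_mulVec (i j : J) (θ : ℝ) (x : J → ℝ) :
    (rotMatrix i j θ).mulVec x = rotInv i j θ x := by
  ext k
  simp only [Matrix.mulVec, rotMatrix, Matrix.of_apply, rotInv]
  split_ifs
  · simp only [dotProduct, add_mul, Finset.sum_add_distrib]
    simp [mul_comm, sub_eq_add_neg]
  · simp only [dotProduct, add_mul, Finset.sum_add_distrib]
    simp [mul_comm]
  · simp [dotProduct]

/-- Conjugation of a diagonal matrix by a rotation. -/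
lemma sum_rotMatrix_mul {i j : J} (hij : i ≠ j) (θ : ℝ) (d : J → ℝ) (k l : J) :
    ∑ m, rotMatrix i j θ k m * d m * rotMatrix i j θ l m
      = (if k = l then d k else 0) + (d i - d j) *
        (Real.sin θ ^ 2 * ((if k = j ∧ l = j then 1 else 0) - if k = i ∧ l = i then 1 else 0)
          + Real.sin θ * Real.cos θ *
            ((if k = i ∧ l = j then 1 else 0) + if k = j ∧ l = i then 1 else 0)) := by
  have hji : j ≠ i := hij.symm
  have hcs := Real.sin_sq_add_cos_sq θ
  -- Rows i and j are supported on {i, j} and all other rows are unit vectors, so the sum collapses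
  -- in each case for k and l.
  have hi : ∀ m, rotMatrix i j θ i m =
      Real.cos θ * (if m = i then 1 else 0) + -Real.sin θ * (if m = j then 1 else 0) := fun m => by
    simp [rotMatrix]
  have hj : ∀ m, rotMatrix i j θ j m =
      Real.sin θ * (if m = i then 1 else 0) + Real.cos θ * (if m = j then 1 else 0) := fun m => by
    simp [rotMatrix, hji]
  have hk : ∀ k, k ≠ i → k ≠ j → ∀ m, rotMatrix i j θ k m = if m = k then 1 else 0 :=
    fun k h1 h2 m => by simp [rotMatrix, h1, h2]
  have hsum : ∀ (a b a' b' : ℝ), ∑ m, (a * (if m = i then 1 else 0) + b * (if m = j then 1 else 0))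
      * d m * (a' * (if m = i then 1 else 0) + b' * (if m = j then 1 else 0))
      = a * a' * d i + b * b' * d j := by
    intro a b a' b'
    have : ∀ m, (a * (if m = i then 1 else 0) + b * (if m = j then 1 else 0))
      * d m * (a' * (if m = i then 1 else 0) + b' * (if m = j then 1 else 0))
      = (if m = i then a * a' * d m else 0) + (if m = j then b * b' * d m else 0) := by
      intro m
      by_cases h1 : m = i
      · have : m ≠ j := h1 ▸ hij
        simp [h1, hij]; ring
      · by_cases h2 : m = j <;> simp [h1, h2, hji]; ring
    simp only [this]
    simp [Finset.sum_add_distrib]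
  have hsum1 : ∀ (a b : ℝ) (l : J), l ≠ i → l ≠ j →
      ∑ m, (a * (if m = i then 1 else 0) + b * (if m = j then 1 else 0)) * d m *
        (if m = l then 1 else 0) = 0 := by
    intro a b l h1 h2
    simp [h1, h2]
  have hsum2 : ∀ (a b : ℝ) (l : J), l ≠ i → l ≠ j →
      ∑ m, (if m = l then 1 else 0) * d m *
        (a * (if m = i then 1 else 0) + b * (if m = j then 1 else 0)) = 0 := by
    intro a b l h1 h2
    simp [h1, h2]
  rcases eq_or_ne k i with rfl | hki
  · rcases eq_or_ne l k with rfl | hli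
    · simp only [hi, hsum]
      simp [hij]
      linear_combination d l * hcs
    · rcases eq_or_ne l j with rfl | hlj
      · simp only [hi, hj, hsum]
        simp [hij, hji]
        ring
      · simp only [hi, hk l hli hlj, hsum1 _ _ l hli hlj]
        simp [hli, hlj, hli.symm]
  · rcases eq_or_ne k j with rfl | hkj
    · rcases eq_or_ne l i with rfl | hli
      · simp only [hi, hj, hsum]
        simp [hij, hji]
        ring
      · rcases eq_or_ne l k with rfl | hlj
        · simp only [hj, hsum]
          simp [hji]
          linear_combination d l * hcs
        · simp only [hj, hk l hli hlj, hsum1 _ _ l hli hlj]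
          simp [hli, hlj, hlj.symm]
    · rcases eq_or_ne l i with rfl | hli
      · simp only [hi, hk k hki hkj, hsum2 _ _ k hki hkj]
        simp [hki, hkj]
      · rcases eq_or_ne l j with rfl | hlj
        · simp only [hj, hk k hki hkj, hsum2 _ _ k hki hkj]
          simp [hki, hkj]
        · simp only [hk k hki hkj, hk l hli hlj]
          rcases eq_or_ne k l with rfl | hkl
          · simp [hki, hkj]
          · simp [hki, hkj, hkl, hkl.symm]

/-- The conjugation formula with constant diagonal, for which the correction d i - d j vanishes. -/
lemma rotMatrix_orthogonal {i j : J} (hij : i ≠ j) (θ : ℝ) :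
    (rotMatrix i j θ).transpose * rotMatrix i j θ = 1 := by
  rw [mul_eq_one_comm]
  ext k l
  have := sum_rotMatrix_mul hij θ (fun _ => 1) k l
  simpa [Matrix.mul_apply, Matrix.one_apply] using this

end RotationMatrix

/-! ### Almost everywhere statements under random rotations. -/

section Skew

variable {J : Type*} [Fintype J] {Ω : Type*} [MeasurableSpace Ω] {R : Ω → Matrix J J ℝ}

lemma measurable_mulVec_of_entries (hRm : ∀ k l, Measurable fun ω => R ω k l) :
    Measurable fun p : Ω × (J → ℝ) => (R p.1).mulVec p.2 := by
  refine measurable_pi_lambda _ fun k => ?_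
  simp only [Matrix.mulVec, dotProduct]
  exact Finset.measurable_sum _ fun l _ => ((hRm k l).comp measurable_fst).mul (by fun_prop)

variable [DecidableEq J] {P : Measure Ω} [IsProbabilityMeasure P]

lemma measurePreserving_mulVec_skew (hRm : ∀ k l, Measurable fun ω => R ω k l)
    (hR : ∀ ω, (R ω).transpose * R ω = 1) :
    MeasurePreserving (fun p : Ω × (J → ℝ) => (R p.1).mulVec p.2) (P.prod volume) volume :=
  measurePreserving_snd.comp ((MeasurePreserving.id P).skew_product (measurable_mulVec_of_entries hRm)
    (Filter.Eventually.of_forall fun ω => (measurePreserving_volume_of_sum_sq (R ω).mulVecLin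
      (sum_sq_mulVec_of_orthogonal (hR ω))).map_eq))

variable (P)

/-- Elements of L¹ are known only almost everywhere; since (ω, x) ↦ R(ω)x carries P times Lebesgue
measure to Lebesgue measure, null sets remain negligible along random rotations. -/
lemma ae_ae_mulVec (hRm : ∀ k l, Measurable fun ω => R ω k l)
    (hR : ∀ ω, (R ω).transpose * R ω = 1) {p : (J → ℝ) → Prop} (hp : ∀ᵐ x, p x) :
    ∀ᵐ x : J → ℝ, ∀ᵐ ω ∂P, p ((R ω).mulVec x) := by
  have h1 : ∀ᵐ q ∂((volume : Measure (J → ℝ)).prod P), p ((R q.2).mulVec q.1) :=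
    (Measure.measurePreserving_swap (μ := (volume : Measure (J → ℝ)))
      (ν := P)).quasiMeasurePreserving.ae
      ((measurePreserving_mulVec_skew hRm hR).quasiMeasurePreserving.ae hp)
  exact Measure.ae_ae_of_ae_prod h1

lemma ae_integrable_mulVec (hRm : ∀ k l, Measurable fun ω => R ω k l)
    (hR : ∀ ω, (R ω).transpose * R ω = 1) {F : (J → ℝ) → ℝ} (hF : Integrable F) :
    ∀ᵐ x : J → ℝ, Integrable (fun ω => F ((R ω).mulVec x)) P :=
  ((measurePreserving_mulVec_skew hRm hR).integrable_comp_of_integrable hF :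
    Integrable (fun p : Ω × (J → ℝ) => F ((R p.1).mulVec p.2)) (P.prod volume)).prod_left_ae

end Skew

/-! ### Operators that average over random rotations and scale D. -/

section RotationAverage

variable {J : Type*} [Fintype J] [DecidableEq J]

lemma abs_mul_mul_le {a b d : ℝ} (ha : |a| ≤ 1) (hb : |b| ≤ 1) : |a * d * b| ≤ |d| := by
  rw [abs_mul, abs_mul]
  exact (mul_le_of_le_one_right (by positivity) hb).trans
    (mul_le_of_le_one_left (abs_nonneg d) ha)

/-- The operator `K` on `L¹(ℝ^J)` is an average `(K F)(x) = E[F(R x)]` over random orthogonal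
matrices `R` such that `E[R D Rᵀ] = q D`, with `D` the diagonal matrix with entries `d`. -/
def IsRotationAverage (d : J → ℝ) (q : ℝ)
    (K : ((J → ℝ) →₁[volume] ℝ) →L[ℝ] ((J → ℝ) →₁[volume] ℝ)) : Prop :=
  ∃ (Ω : Type) (_ : MeasurableSpace Ω) (P : Measure Ω) (_ : IsProbabilityMeasure P)
    (R : Ω → Matrix J J ℝ), (∀ k l, Measurable fun ω => R ω k l) ∧
    (∀ ω, (R ω).transpose * R ω = 1) ∧
    (∀ k l, ∫ ω, ∑ m, R ω k m * d m * R ω l m ∂P = if k = l then q * d k else 0) ∧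
    ∀ F, K F =ᵐ[volume] fun x => ∫ ω, F ((R ω).mulVec x) ∂P

lemma isRotationAverage_one (d : J → ℝ) :
    IsRotationAverage d 1 (1 : ((J → ℝ) →₁[volume] ℝ) →L[ℝ] ((J → ℝ) →₁[volume] ℝ)) := by
  refine ⟨Unit, inferInstance, Measure.dirac (), inferInstance, fun _ => 1, by fun_prop, by simp,
    fun k l => ?_, fun F => Filter.Eventually.of_forall fun x => by simp⟩
  rcases eq_or_ne k l with rfl | hkl
  · simp [Matrix.one_apply]
  · simp [Matrix.one_apply, hkl]

/-- The composition averages F(R₂ R₁ x) over independent R₁ and R₂. Taking the expectation over R₁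
first replaces R₁ D R₁ᵀ by q₁ D inside the conjugation by R₂. -/
lemma IsRotationAverage.mul {d : J → ℝ} {q₁ q₂ : ℝ}
    {K₁ K₂ : ((J → ℝ) →₁[volume] ℝ) →L[ℝ] ((J → ℝ) →₁[volume] ℝ)}
    (h₁ : IsRotationAverage d q₁ K₁) (h₂ : IsRotationAverage d q₂ K₂) :
    IsRotationAverage d (q₁ * q₂) (K₁ * K₂) := by
  obtain ⟨Ω₁, _, P₁, _, R₁, m₁, o₁, c₁, k₁⟩ := h₁
  obtain ⟨Ω₂, _, P₂, _, R₂, m₂, o₂, c₂, k₂⟩ := h₂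
  have hm : ∀ k l, Measurable fun p : Ω₁ × Ω₂ => (R₂ p.2 * R₁ p.1) k l := fun k l => by
    simp only [Matrix.mul_apply]
    exact Finset.measurable_sum _ fun a _ =>
      ((m₂ k a).comp measurable_snd).mul ((m₁ a l).comp measurable_fst)
  have ho : ∀ p : Ω₁ × Ω₂, (R₂ p.2 * R₁ p.1).transpose * (R₂ p.2 * R₁ p.1) = 1 := fun p => by
    rw [Matrix.transpose_mul, Matrix.mul_assoc, ← Matrix.mul_assoc (R₂ p.2).transpose, o₂,
      Matrix.one_mul, o₁]
  have b₁ : ∀ ω k l, |R₁ ω k l| ≤ 1 := fun ω => abs_entry_le_one_of_orthogonal (o₁ ω)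
  have b₂ : ∀ ω k l, |R₂ ω k l| ≤ 1 := fun ω => abs_entry_le_one_of_orthogonal (o₂ ω)
  have i₁ : ∀ a b m, Integrable (fun ω => R₁ ω a m * d m * R₁ ω b m) P₁ := fun a b m =>
    integrable_of_bounded (C := |d m|) (((m₁ _ _).mul_const _).mul (m₁ _ _)) fun ω => by
      exact abs_mul_mul_le (b₁ _ _ _) (b₁ _ _ _)
  have i₂ : ∀ k l a b, Integrable (fun ω => R₂ ω k a * R₂ ω l b) P₂ := fun k l a b =>
    integrable_of_bounded (C := 1) ((m₂ _ _).mul (m₂ _ _)) fun ω => by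
      rw [abs_mul]; exact mul_le_one₀ (b₂ _ _ _) (abs_nonneg _) (b₂ _ _ _)
  have s₁ : ∀ a b, Integrable (fun ω => ∑ m, R₁ ω a m * d m * R₁ ω b m) P₁ := fun a b =>
    integrable_finsetSum _ fun m _ => i₁ a b m
  refine ⟨Ω₁ × Ω₂, inferInstance, P₁.prod P₂, inferInstance, fun p => R₂ p.2 * R₁ p.1, hm, ho,
    fun k l => ?_, fun F => ?_⟩
  · have h1 : ∀ p : Ω₁ × Ω₂, ∑ m, (R₂ p.2 * R₁ p.1) k m * d m * (R₂ p.2 * R₁ p.1) l m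
        = ∑ a, ∑ b, (∑ m, R₁ p.1 a m * d m * R₁ p.1 b m) * (R₂ p.2 k a * R₂ p.2 l b) := by
      intro p
      simp_rw [Matrix.mul_apply, Finset.sum_mul, Finset.mul_sum]
      rw [Finset.sum_comm]
      refine Finset.sum_congr rfl fun a _ => ?_
      rw [Finset.sum_comm]
      exact Finset.sum_congr rfl fun b _ => Finset.sum_congr rfl fun m _ => by ring
    simp only [h1]
    have h2 : ∀ a b, Integrable (fun p : Ω₁ × Ω₂ => (∑ m, R₁ p.1 a m * d m * R₁ p.1 b m) *
        (R₂ p.2 k a * R₂ p.2 l b)) (P₁.prod P₂) := fun a b => (s₁ a b).mul_prod (i₂ k l a b)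
    rw [integral_finsetSum _ fun a _ => integrable_finsetSum _ fun b _ => h2 a b]
    have h3 : ∀ a, ∫ p : Ω₁ × Ω₂, ∑ b, (∑ m, R₁ p.1 a m * d m * R₁ p.1 b m) *
        (R₂ p.2 k a * R₂ p.2 l b) ∂P₁.prod P₂
        = q₁ * ∫ ω, R₂ ω k a * d a * R₂ ω l a ∂P₂ := by
      intro a
      rw [integral_finsetSum _ fun b _ => h2 a b]
      -- Independence factorises the expectation, and the hypothesis on R₁ leaves only the diagonal
      -- terms a = b.
      have h4 : ∀ b, ∫ p : Ω₁ × Ω₂, (∑ m, R₁ p.1 a m * d m * R₁ p.1 b m) *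
          (R₂ p.2 k a * R₂ p.2 l b) ∂P₁.prod P₂
          = (if a = b then q₁ * d a else 0) * ∫ ω, R₂ ω k a * R₂ ω l b ∂P₂ := fun b => by
        rw [← c₁ a b]
        exact integral_prod_mul (fun ω => ∑ m, R₁ ω a m * d m * R₁ ω b m)
          (fun ω => R₂ ω k a * R₂ ω l b)
      simp only [h4, ite_mul, zero_mul, Finset.sum_ite_eq, Finset.mem_univ, if_true]
      rw [mul_assoc, ← integral_const_mul]
      congr 2
      ext ω
      ring
    simp only [h3]
    rw [← Finset.mul_sum, ← integral_finsetSum _ fun a _ => ?_, c₂]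
    · split_ifs <;> ring
    · refine ((i₂ k l a a).mul_const (d a)).congr (Filter.Eventually.of_forall fun ω => ?_)
      simp only
      ring
  · have h1 := ae_ae_mulVec P₁ m₁ o₁ (k₂ F)
    have h2 := ae_integrable_mulVec (P₁.prod P₂) hm ho (L1.integrable_coeFn F)
    filter_upwards [k₁ (K₂ F), h1, h2] with x hx1 hx2 hx3
    rw [mul_apply_eq_comp, hx1, integral_prod _ hx3]
    refine integral_congr_ae ?_
    filter_upwards [hx2] with ω hω
    rw [hω]
    simp only [Matrix.mulVec_mulVec]

lemma IsRotationAverage.pow {d : J → ℝ} {q : ℝ}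
    {K : ((J → ℝ) →₁[volume] ℝ) →L[ℝ] ((J → ℝ) →₁[volume] ℝ)}
    (h : IsRotationAverage d q K) (n : ℕ) : IsRotationAverage d (q ^ n) (K ^ n) := by
  induction n with
  | zero => simpa using isRotationAverage_one d
  | succ n ih => rw [pow_succ, pow_succ]; exact ih.mul h

lemma coeFn_sum_L1 {A X : Type*} [MeasurableSpace X] {μ : Measure X} (s : Finset A)
    (f : A → X →₁[μ] ℝ) : (∑ a ∈ s, f a : X →₁[μ] ℝ) =ᵐ[μ] fun x => ∑ a ∈ s, f a x := by
  classical
  induction s using Finset.induction_on with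
  | empty => simp only [Finset.sum_empty]; exact Lp.coeFn_zero ℝ 1 μ
  | insert a s ha ih =>
    rw [Finset.sum_insert ha]
    filter_upwards [Lp.coeFn_add (f a) (∑ a ∈ s, f a), ih] with x h1 h2
    rw [h1, Pi.add_apply, h2, Finset.sum_insert ha]

/-- A small step of a sum of collision operators is an average over rotations. -/
lemma isRotationAverage_step {A : Type} [Fintype A] [DecidableEq A] {i j : A → J} (hij : ∀ a, i a ≠ j a)
    {c : A → ℝ} (hc : ∀ a, 0 ≤ c a) (ν : Measure ℝ) [IsProbabilityMeasure ν]
    (hν : ∫ θ, Real.sin θ * Real.cos θ ∂ν = 0) {δ : ℝ} (hδ : 0 ≤ δ) (hδc : δ * ∑ a, c a ≤ 1)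
    {d : J → ℝ} {lam : ℝ} (hd : ∀ k, ∑ a, c a * ((d (i a) - d (j a)) * (∫ θ, Real.sin θ ^ 2 ∂ν) *
      ((if k = j a then 1 else 0) - if k = i a then 1 else 0)) = -lam * d k) :
    IsRotationAverage d (1 - δ * lam)
      (1 + δ • ∑ a, c a • (collision ν (i a) (j a) (hij a) - ContinuousLinearMap.id ℝ _)) := by
  -- The value `none` stands for no collision and takes the remaining weight, which is nonnegative
  -- because δ ∑ c ≤ 1.
  let w : Option A → ℝ := fun o => o.elim (1 - δ * ∑ a, c a) fun a => δ * c a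
  have hw : ∀ o, 0 ≤ w o := by
    rintro (_ | a)
    · exact sub_nonneg.2 hδc
    · exact mul_nonneg hδ (hc a)
  have hw1 : ∑ o, w o = 1 := by
    simp [w, Fintype.sum_option, Finset.mul_sum]
  let : MeasurableSpace (Option A) := ⊤
  let P₀ : Measure (Option A) := ∑ o, ENNReal.ofReal (w o) • Measure.dirac o
  have : IsProbabilityMeasure P₀ := ⟨by
    simp only [P₀, Measure.finsetSum_apply, Measure.smul_apply, measure_univ, smul_eq_mul, mul_one]
    rw [← ENNReal.ofReal_sum_of_nonneg fun o _ => hw o, hw1, ENNReal.ofReal_one]⟩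
  have hP₀ : ∀ f : Option A → ℝ, ∫ o, f o ∂P₀ = ∑ o, w o * f o := by
    intro f
    rw [integral_finsetSum_measure fun o _ => ?_]
    · refine Finset.sum_congr rfl fun o _ => ?_
      rw [integral_smul_measure, integral_dirac, ENNReal.toReal_ofReal (hw o), smul_eq_mul]
    · exact (integrable_dirac (by simp)).smul_measure ENNReal.ofReal_ne_top
  let R : Option A × ℝ → Matrix J J ℝ := fun p => p.1.elim 1 fun a => rotMatrix (i a) (j a) p.2
  have hRm : ∀ k l, Measurable fun p => R p k l := by
    intro k l
    refine measurable_from_prod_countable_right fun o => ?_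
    cases o with
    | none => exact measurable_const
    | some a => exact measurable_rotMatrix (i a) (j a) k l
  have hRo : ∀ p, (R p).transpose * R p = 1 := by
    rintro ⟨_ | a, θ⟩
    · simp [R]
    · exact rotMatrix_orthogonal (hij a) θ
  have hInt : ∀ f : Option A × ℝ → ℝ, Integrable f (P₀.prod ν) →
      ∫ p, f p ∂P₀.prod ν = (1 - δ * ∑ a, c a) * (∫ θ, f (none, θ) ∂ν)
        + ∑ a, δ * c a * ∫ θ, f (some a, θ) ∂ν := by
    intro f hf
    rw [integral_prod _ hf, hP₀, Fintype.sum_option]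
    rfl
  have hsin : Integrable (fun θ => Real.sin θ ^ 2) ν :=
    integrable_of_bounded (C := 1) (by fun_prop) fun θ => by
      rw [abs_pow]; exact pow_le_one₀ (abs_nonneg _) (Real.abs_sin_le_one θ)
  have hsc : Integrable (fun θ => Real.sin θ * Real.cos θ) ν :=
    integrable_of_bounded (C := 1) (by fun_prop) fun θ => by
      rw [abs_mul]; exact mul_le_one₀ (Real.abs_sin_le_one θ) (abs_nonneg _) (Real.abs_cos_le_one θ)
  -- Here the condition ∫ sin θ cos θ dν = 0 enters: it removes the off-diagonal part of the
  -- conjugated matrix.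
  have hlin : ∀ x y z u : ℝ, ∫ θ, x + y * (Real.sin θ ^ 2 * z + Real.sin θ * Real.cos θ * u) ∂ν
      = x + y * (∫ θ, Real.sin θ ^ 2 ∂ν) * z := by
    intro x y z u
    have i1 : Integrable (fun θ => Real.sin θ ^ 2 * z + Real.sin θ * Real.cos θ * u) ν :=
      (hsin.mul_const z).add (hsc.mul_const u)
    rw [integral_add (integrable_const x) (i1.const_mul y), integral_const_mul,
      integral_add (hsin.mul_const z) (hsc.mul_const u), integral_mul_const, integral_mul_const, hν]
    simp [mul_assoc]
  refine ⟨Option A × ℝ, inferInstance, P₀.prod ν, inferInstance, R, hRm, hRo, fun k l => ?_,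
    fun F => ?_⟩
  · rw [hInt]
    · have h1 : ∀ a, ∫ θ, ∑ m, R (some a, θ) k m * d m * R (some a, θ) l m ∂ν
          = (if k = l then d k else 0) + (d (i a) - d (j a)) * (∫ θ, Real.sin θ ^ 2 ∂ν) *
            ((if k = j a ∧ l = j a then 1 else 0) - if k = i a ∧ l = i a then 1 else 0) := by
        intro a
        simp only [R, Option.elim_some, sum_rotMatrix_mul (hij a)]
        exact hlin _ _ _ _
      have h0 : ∫ θ, ∑ m, R (none, θ) k m * d m * R (none, θ) l m ∂ν = if k = l then d k else 0 := by
        rcases eq_or_ne k l with rfl | hkl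
        · simp [R, Matrix.one_apply]
        · simp [R, Matrix.one_apply, hkl]
      rw [h0]
      simp only [h1]
      rcases eq_or_ne k l with rfl | hkl
      · have h2 := hd k
        simp only [if_true, and_self, mul_add, Finset.sum_add_distrib]
        have h3 : ∑ a, δ * c a * ((d (i a) - d (j a)) * (∫ θ, Real.sin θ ^ 2 ∂ν) *
            ((if k = j a then 1 else 0) - if k = i a then 1 else 0)) = δ * (-lam * d k) := by
          rw [← h2, Finset.mul_sum]
          exact Finset.sum_congr rfl fun a _ => by ring
        rw [h3, ← Finset.sum_mul, ← Finset.mul_sum]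
        ring
      · have h2 : ∀ b : J, ¬(k = b ∧ l = b) := fun b h => hkl (h.1.trans h.2.symm)
        simp [hkl, h2]
    · refine integrable_finsetSum _ fun m _ => integrable_of_bounded (C := |d m|)
        (((hRm _ _).mul_const _).mul (hRm _ _)) fun p => ?_
      exact abs_mul_mul_le (abs_entry_le_one_of_orthogonal (hRo p) _ _)
        (abs_entry_le_one_of_orthogonal (hRo p) _ _)
  · have h1 := ae_integrable_mulVec (P₀.prod ν) hRm hRo (L1.integrable_coeFn F)
    have h2 : ∀ᵐ x : J → ℝ, ∀ a, collision ν (i a) (j a) (hij a) F x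
        = ∫ θ, F (rotInv (i a) (j a) θ x) ∂ν :=
      ae_all_iff.2 fun a => coeFn_collision ν (i a) (j a) (hij a) F
    have h3 : ((1 : ((J → ℝ) →₁[volume] ℝ) →L[ℝ] ((J → ℝ) →₁[volume] ℝ)) + δ • ∑ a, c a •
        (collision ν (i a) (j a) (hij a) - ContinuousLinearMap.id ℝ _)) F
        = F + δ • ∑ a, c a • (collision ν (i a) (j a) (hij a) F - F) := by
      simp
    have h4 : ∀ᵐ x : J → ℝ, (F + δ • ∑ a, c a • (collision ν (i a) (j a) (hij a) F - F) :
        (J → ℝ) →₁[volume] ℝ) x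
        = F x + δ * ∑ a, c a * (collision ν (i a) (j a) (hij a) F x - F x) := by
      have e1 := Lp.coeFn_add F (δ • ∑ a, c a • (collision ν (i a) (j a) (hij a) F - F))
      have e2 := Lp.coeFn_smul δ (∑ a, c a • (collision ν (i a) (j a) (hij a) F - F))
      have e3 := coeFn_sum_L1 Finset.univ fun a =>
        c a • (collision ν (i a) (j a) (hij a) F - F)
      have e4 : ∀ᵐ x : J → ℝ, ∀ a, (c a • (collision ν (i a) (j a) (hij a) F - F) :
          (J → ℝ) →₁[volume] ℝ) x = c a * (collision ν (i a) (j a) (hij a) F x - F x) := by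
        refine ae_all_iff.2 fun a => ?_
        filter_upwards [Lp.coeFn_smul (c a) (collision ν (i a) (j a) (hij a) F - F),
          Lp.coeFn_sub (collision ν (i a) (j a) (hij a) F) F] with x h h'
        rw [h, Pi.smul_apply, h', Pi.sub_apply, smul_eq_mul]
      filter_upwards [e1, e2, e3, e4] with x e1 e2 e3 e4
      rw [e1, Pi.add_apply, e2, Pi.smul_apply, e3, smul_eq_mul]
      simp only [e4]
    rw [h3]
    filter_upwards [h1, h2, h4] with x hx1 hx2 hx4
    rw [hx4, hInt _ hx1]
    simp only [R, Option.elim_none, Option.elim_some, Matrix.one_mulVec, rotMatrix_mulVec, hx2,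
      integral_const, probReal_univ, one_smul, mul_sub, Finset.sum_sub_distrib]
    rw [← Finset.sum_mul, Finset.mul_sum]
    simp only [mul_assoc]
    ring

end RotationAverage

/-! ### Euler's limit for the exponential in a normed algebra. -/

section Exponential

open Filter Topology

/-- The case n = 0 needs ‖1‖ ≤ 1, assumed in place of `NormOneClass`; for operators it is supplied
by `ContinuousLinearMap.norm_id_le`. -/
lemma norm_pow_le_of_norm_one_le {𝔸 : Type*} [NormedRing 𝔸] (h1 : ‖(1 : 𝔸)‖ ≤ 1) (a : 𝔸) (n : ℕ) : ‖a ^ n‖ ≤ ‖a‖ ^ n := by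
  rcases Nat.eq_zero_or_pos n with rfl | hn
  · simpa using h1
  · exact norm_pow_le' a hn

variable {𝔸 : Type*} [NormedRing 𝔸] [NormedAlgebra ℝ 𝔸]

lemma norm_exp_le_of_norm_one_le (h1 : ‖(1 : 𝔸)‖ ≤ 1) (a : 𝔸) :
    ‖NormedSpace.exp a‖ ≤ Real.exp ‖a‖ := by
  rw [NormedSpace.exp_eq_tsum ℝ, Real.exp_eq_exp_ℝ, NormedSpace.exp_eq_tsum ℝ]
  refine tsum_of_norm_bounded (NormedSpace.expSeries_summable' (𝕂 := ℝ) ‖a‖).hasSum fun n => ?_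
  rw [norm_smul, smul_eq_mul, norm_inv, RCLike.norm_natCast]
  exact mul_le_mul_of_nonneg_left (norm_pow_le_of_norm_one_le h1 a n) (by positivity)

/-- `exp X` is the limit of `(1 + X / n) ^ n`. -/
lemma tendsto_one_add_inv_smul_pow_exp [CompleteSpace 𝔸] (h1 : ‖(1 : 𝔸)‖ ≤ 1) (X : 𝔸) :
    Tendsto (fun n : ℕ => (1 + ((n : ℝ)⁻¹) • X) ^ n) atTop (𝓝 (NormedSpace.exp X)) := by
  have hlim0 : Tendsto (fun n : ℕ => ((n : ℝ)⁻¹) • X) atTop (𝓝 0) := by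
    simpa using (tendsto_inv_atTop_nhds_zero_nat (𝕜 := ℝ)).smul_const X
  have hlo := ((hasFDerivAt_exp_zero (𝕂 := ℝ) (𝔸 := 𝔸)).isLittleO.comp_tendsto hlim0)
  rw [Metric.tendsto_atTop]
  intro ε hε
  -- The tolerance ε / (2B) makes the total error at most ε / 2; the summand 1 keeps B positive when
  -- X = 0.
  set B := Real.exp ‖X‖ * (‖X‖ + 1) with hB
  have hB0 : 0 < B := by positivity
  have hev := hlo.def (show 0 < ε / (2 * B) by positivity)
  obtain ⟨n₀, hn₀⟩ := eventually_atTop.1 hev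
  refine ⟨n₀ + 1, fun n hn => ?_⟩
  have hn1 : 0 < n := by omega
  have hnR : (0 : ℝ) < n := by exact_mod_cast hn1
  have h2 := hn₀ n (by omega)
  set Y := ((n : ℝ)⁻¹) • X with hY
  have hYn : ‖Y‖ = ‖X‖ / n := by
    rw [hY, norm_smul, norm_inv, RCLike.norm_natCast]; field_simp
  simp only [Function.comp_apply, NormedSpace.exp_zero, sub_zero, one_apply_eq_self] at h2
  have hexp : NormedSpace.exp X = NormedSpace.exp Y ^ n := by
    let +nondep : NormedAlgebra ℚ 𝔸 := NormedAlgebra.restrictScalars ℚ ℝ 𝔸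
    rw [← NormedSpace.exp_nsmul, hY, ← Nat.cast_smul_eq_nsmul ℝ, smul_smul,
      mul_inv_cancel₀ hnR.ne', one_smul]
  have hcomm : Commute (1 + Y) (NormedSpace.exp Y) :=
    (Commute.one_left _).add_left (Commute.refl Y).exp_right
  have ha : ‖1 + Y‖ ≤ Real.exp (‖X‖ / n) := by
    rw [← hYn]
    calc ‖1 + Y‖ ≤ ‖(1 : 𝔸)‖ + ‖Y‖ := norm_add_le _ _
      _ ≤ ‖Y‖ + 1 := by linarith
      _ ≤ _ := Real.add_one_le_exp _
  have hb : ‖NormedSpace.exp Y‖ ≤ Real.exp (‖X‖ / n) := by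
    rw [← hYn]; exact norm_exp_le_of_norm_one_le h1 Y
  -- The cofactor in aⁿ - bⁿ = (a - b) ∑ aⁱ bⁿ⁻¹⁻ⁱ grows only linearly in n, while a - b is o(1/n).
  have hgeom : ‖∑ i ∈ Finset.range n, (1 + Y) ^ i * NormedSpace.exp Y ^ (n - 1 - i)‖
      ≤ n * Real.exp ‖X‖ := by
    refine (norm_sum_le _ _).trans ?_
    rw [← nsmul_eq_mul]
    conv_rhs => rw [← Finset.card_range n, ← Finset.sum_const]
    refine Finset.sum_le_sum fun i hi => ?_
    have hi' := Finset.mem_range.1 hi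
    calc ‖(1 + Y) ^ i * NormedSpace.exp Y ^ (n - 1 - i)‖
        ≤ ‖(1 + Y) ^ i‖ * ‖NormedSpace.exp Y ^ (n - 1 - i)‖ := norm_mul_le _ _
      _ ≤ Real.exp (‖X‖ / n) ^ i * Real.exp (‖X‖ / n) ^ (n - 1 - i) := by
          refine mul_le_mul ((norm_pow_le_of_norm_one_le h1 _ _).trans
            (pow_le_pow_left₀ (norm_nonneg _) ha _)) ((norm_pow_le_of_norm_one_le h1 _ _).trans
            (pow_le_pow_left₀ (norm_nonneg _) hb _)) (norm_nonneg _) (by positivity)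
      _ = Real.exp (‖X‖ / n) ^ (n - 1) := by rw [← pow_add]; congr 1; omega
      _ ≤ Real.exp (‖X‖ / n) ^ n :=
          pow_le_pow_right₀ (Real.one_le_exp (by positivity)) (by omega)
      _ = Real.exp ‖X‖ := by rw [← Real.exp_nat_mul]; congr 1; field_simp
  rw [dist_eq_norm, hexp, ← hcomm.mul_geom_sum₂]
  calc ‖(1 + Y - NormedSpace.exp Y) *
        ∑ i ∈ Finset.range n, (1 + Y) ^ i * NormedSpace.exp Y ^ (n - 1 - i)‖
      ≤ ‖1 + Y - NormedSpace.exp Y‖ * (n * Real.exp ‖X‖) :=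
        (norm_mul_le _ _).trans (mul_le_mul_of_nonneg_left hgeom (norm_nonneg _))
    _ ≤ (ε / (2 * B) * ‖Y‖) * (n * Real.exp ‖X‖) := by
        refine mul_le_mul_of_nonneg_right ?_ (by positivity)
        rw [← norm_neg]
        rw [show -(1 + Y - NormedSpace.exp Y) = NormedSpace.exp Y - 1 - Y by abel]
        exact h2
    _ = ε / 2 * ((Real.exp ‖X‖ * ‖X‖) / B) := by
        rw [hYn]; field_simp
    _ ≤ ε / 2 * 1 := by
        refine mul_le_mul_of_nonneg_left ?_ (by positivity)
        rw [div_le_one hB0, hB]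
        exact mul_le_mul_of_nonneg_left (by linarith) (by positivity)
    _ < ε := by linarith

end Exponential

/-! ### The generator as a sum over pairs, and its action on the energy excess. -/

section Generator

variable (M N : ℕ) (lamS lamR mu : ℝ) (ν : Measure ℝ) [IsProbabilityMeasure ν]

/-- The colliding pairs: within the system, within the reservoir, between the two. -/
abbrev PairIndex : Type :=
  {p : Fin M × Fin M // p.1 < p.2} ⊕ ({p : Fin N × Fin N // p.1 < p.2} ⊕ (Fin M × Fin N))

variable {M N} in
/-- The first particle of a pair. -/
def pairFst : PairIndex M N → Particle M N
  | .inl p => Sum.inl p.1.1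
  | .inr (.inl p) => Sum.inr p.1.1
  | .inr (.inr p) => Sum.inl p.1

variable {M N} in
/-- The second particle of a pair. -/
def pairSnd : PairIndex M N → Particle M N
  | .inl p => Sum.inl p.1.2
  | .inr (.inl p) => Sum.inr p.1.2
  | .inr (.inr p) => Sum.inr p.2

variable {M N} in
lemma pairFst_ne_pairSnd : ∀ a : PairIndex M N, pairFst a ≠ pairSnd a
  | .inl p => fun h => p.2.ne (Sum.inl.inj h)
  | .inr (.inl p) => fun h => p.2.ne (Sum.inr.inj h)
  | .inr (.inr _) => Sum.inl_ne_inr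

/-- The collision rate of a pair. -/
def pairRate : PairIndex M N → ℝ
  | .inl _ => lamS / ((M : ℝ) - 1)
  | .inr (.inl _) => lamR / ((N : ℝ) - 1)
  | .inr (.inr _) => mu / (N : ℝ)

lemma generator_eq_sum : generator M N lamS lamR mu ν =
    ∑ a, pairRate M N lamS lamR mu a • (collision ν (pairFst a) (pairSnd a) (pairFst_ne_pairSnd a)
      - ContinuousLinearMap.id ℝ (State M N)) := by
  rw [Fintype.sum_sum_type, Fintype.sum_sum_type, Fintype.sum_prod_type, generator]
  simp only [Finset.smul_sum, pairRate, pairFst, pairSnd, add_assoc]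

lemma pairRate_nonneg (hM : 1 ≤ M) (hN : 1 ≤ N) (hlamS : 0 ≤ lamS) (hlamR : 0 ≤ lamR)
    (hmu : 0 ≤ mu) (a : PairIndex M N) : 0 ≤ pairRate M N lamS lamR mu a := by
  have hM' : (1 : ℝ) ≤ M := by exact_mod_cast hM
  have hN' : (1 : ℝ) ≤ N := by exact_mod_cast hN
  rcases a with a | a | a
  -- For M = 1 the denominator is 0 and the quotient is 0, so M - 1 ≥ 0 suffices.
  · exact div_nonneg hlamS (by linarith)
  · exact div_nonneg hlamR (by linarith)
  · exact div_nonneg hmu (by linarith)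

/-- The energy excess of the system over its equilibrium share `M / (N + M)`. -/
def excess : Particle M N → ℝ :=
  Sum.elim (fun _ => (N : ℝ) / (N + M)) fun _ => -((M : ℝ) / (N + M))

/-- Pairs within one group have equal excess and exchange nothing; for a mixed pair the difference
of excesses is 1. A system particle has N mixed partners and loses μS in total, a reservoir particle
has M of them and gains μS M/N, and both agree with the same eigenvalue. -/
lemma sum_pairRate_excess (hM : 1 ≤ M) (hN : 1 ≤ N) (S : ℝ) (k : Particle M N) :
    ∑ a, pairRate M N lamS lamR mu a *
        ((excess M N (pairFst a) - excess M N (pairSnd a)) * S *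
          ((if k = pairSnd a then 1 else 0) - if k = pairFst a then 1 else 0))
      = -(mu * S * (N + M) / N) * excess M N k := by
  have hM' : (0 : ℝ) < M := by exact_mod_cast hM
  have hN' : (0 : ℝ) < N := by exact_mod_cast hN
  have hNM : (N : ℝ) + M ≠ 0 := by positivity
  rw [Fintype.sum_sum_type, Fintype.sum_sum_type, Fintype.sum_prod_type]
  simp only [pairFst, pairSnd, pairRate, excess, Sum.elim_inl, Sum.elim_inr, sub_self, zero_mul,
    mul_zero, Finset.sum_const_zero, zero_add]
  rcases k with k | k
  · simp
    field_simp
  · simp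
    field_simp

lemma isRotationAverage_generator_step (hM : 1 ≤ M) (hN : 1 ≤ N) (hlamS : 0 ≤ lamS)
    (hlamR : 0 ≤ lamR) (hmu : 0 ≤ mu) (hν : ∫ θ, Real.sin θ * Real.cos θ ∂ν = 0) {δ : ℝ}
    (hδ : 0 ≤ δ) (hδ1 : δ * ∑ a, pairRate M N lamS lamR mu a ≤ 1) :
    IsRotationAverage (excess M N) (1 - δ * (mu * (∫ θ, Real.sin θ ^ 2 ∂ν) * (N + M) / N))
      (1 + δ • generator M N lamS lamR mu ν) := by
  rw [generator_eq_sum]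
  exact isRotationAverage_step pairFst_ne_pairSnd (pairRate_nonneg M N lamS lamR mu hM hN hlamS
    hlamR hmu) ν hν hδ hδ1 (sum_pairRate_excess M N lamS lamR mu hM hN _)

end Generator

/-! ### Regular approximation of densities with control of the entropy. -/

section Approximation

open Filter Topology InformationTheory
open scoped Convolution ContDiff

lemma klFun_le_max_of_mem_Icc {a b x : ℝ} (ha : 0 ≤ a) (hx : x ∈ Set.Icc a b) :
    klFun x ≤ max (klFun a) (klFun b) :=
  convexOn_klFun.le_max_of_mem_Icc (Set.mem_Ici.2 ha)
    (Set.mem_Ici.2 (ha.trans (hx.1.trans hx.2))) hx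

/-- `klFun` is convex with minimum at 1, and clamping to an interval that contains 1 moves the
argument towards 1. -/
lemma klFun_clamp_le {a b x : ℝ} (ha1 : a ≤ 1) (hb1 : 1 ≤ b) (hx : 0 ≤ x) :
    klFun (max a (min x b)) ≤ klFun x := by
  have h0 := klFun_nonneg hx
  rcases le_total x 1 with h | h
  · have := klFun_le_max_of_mem_Icc (x := max a (min x b)) hx
      ⟨le_max_of_le_right (le_min le_rfl (h.trans hb1)), max_le ha1 (min_le_of_left_le h)⟩
    rwa [klFun_one, max_eq_left h0] at this
  · have := klFun_le_max_of_mem_Icc (x := max a (min x b)) zero_le_one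
      ⟨le_max_of_le_right (le_min h hb1), max_le (ha1.trans h) (min_le_left x b)⟩
    rwa [klFun_one, max_eq_right h0] at this

lemma klFun_le_of_mem_Icc {K x : ℝ} (hx : x ∈ Set.Icc 0 K) : klFun x ≤ 1 + klFun K := by
  have h := klFun_le_max_of_mem_Icc le_rfl hx
  have hK := klFun_nonneg (hx.1.trans hx.2)
  rw [klFun_zero] at h
  exact h.trans (max_le (by linarith) (by linarith))

variable {ι : Type*} [Fintype ι] [DecidableEq ι]

/-- The gradient is continuous with compact support, because u is constant outside a compact set;
hence it is bounded. -/
lemma exists_isRegular_of_contDiff {u : (ι → ℝ) → ℝ} (hu : ContDiff ℝ 1 u)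
    (hc : HasCompactSupport (fun x => u x - 1)) {m K : ℝ} (hm : 0 < m)
    (hb : ∀ x, u x ∈ Set.Icc m K) : ∃ g C, IsRegular u g m K C := by
  have hcont : ∀ k : ι, Continuous fun x => fderiv ℝ u x (Pi.single k 1) := fun k =>
    (hu.continuous_fderiv one_ne_zero).clm_apply continuous_const
  have hsupp : HasCompactSupport (fderiv ℝ u) := by
    have e : fderiv ℝ (fun x => u x - 1) = fderiv ℝ u := funext fun x => fderiv_sub_const 1
    exact e ▸ hc.fderiv (𝕜 := ℝ)
  have hbd : ∀ k : ι, ∃ C, ∀ x, ‖fderiv ℝ u x (Pi.single k 1)‖ ≤ C := fun k =>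
    (hsupp.comp_left (g := fun L : (ι → ℝ) →L[ℝ] ℝ => L (Pi.single k 1))
      (by simp)).exists_bound_of_continuous (hcont k)
  choose C hC using hbd
  refine ⟨fun k x => fderiv ℝ u x (Pi.single k 1), ∑ k, |C k|, hm, fun x => (hb x).1,
    fun x => (hb x).2, fun x => ?_, fun k => (hcont k).measurable, fun k x => ?_⟩
  · refine ((hu.differentiable one_ne_zero) x).hasFDerivAt.congr_fderiv ?_
    ext y
    conv_lhs => rw [← Finset.univ_sum_single y]
    simp only [map_sum, FunLike.coe_sum, Finset.sum_apply, FunLike.coe_smul, Pi.smul_apply,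
      ContinuousLinearMap.proj_apply, smul_eq_mul]
    refine Finset.sum_congr rfl fun k _ => ?_
    have : (Pi.single k (y k) : ι → ℝ) = y k • Pi.single k 1 := by
      rw [← Pi.single_smul, smul_eq_mul, mul_one]
    rw [this, map_smul, smul_eq_mul, mul_comm]
  · exact ((hC k x).trans (le_abs_self _)).trans
      (Finset.single_le_sum (f := fun k => |C k|) (fun _ _ => abs_nonneg _) (Finset.mem_univ k))

omit [DecidableEq ι] in
lemma tendsto_integral_klFun_of_bounded {f : ℕ → (ι → ℝ) → ℝ} {p : (ι → ℝ) → ℝ} {K : ℝ}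
    (hf : ∀ n, AEStronglyMeasurable (f n) (gauss ι)) (hfb : ∀ n x, f n x ∈ Set.Icc 0 K)
    (hlim : ∀ᵐ x ∂gauss ι, Tendsto (fun n => f n x) atTop (𝓝 (p x))) :
    Tendsto (fun n => ∫ x, klFun (f n x) ∂gauss ι) atTop (𝓝 (∫ x, klFun (p x) ∂gauss ι)) := by
  refine tendsto_integral_of_dominated_convergence (fun _ => 1 + klFun K)
    (fun n => continuous_klFun.comp_aestronglyMeasurable (hf n)) (integrable_const _)
    (fun n => Eventually.of_forall fun x => ?_) ?_
  · rw [Real.norm_of_nonneg (klFun_nonneg (hfb n x).1)]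
    exact klFun_le_of_mem_Icc (hfb n x)
  · filter_upwards [hlim] with x hx
    exact (continuous_klFun.tendsto _).comp hx

omit [DecidableEq ι] in
lemma tendsto_integral_abs_sub_of_bounded {f : ℕ → (ι → ℝ) → ℝ} {p B : (ι → ℝ) → ℝ}
    (hf : ∀ n, AEStronglyMeasurable (f n) (gauss ι)) (hp : AEStronglyMeasurable p (gauss ι))
    (hB : Integrable B (gauss ι)) (hfb : ∀ n, ∀ᵐ x ∂gauss ι, |f n x - p x| ≤ B x)
    (hlim : ∀ᵐ x ∂gauss ι, Tendsto (fun n => f n x) atTop (𝓝 (p x))) :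
    Tendsto (fun n => ∫ x, |f n x - p x| ∂gauss ι) atTop (𝓝 0) := by
  have := tendsto_integral_of_dominated_convergence (μ := gauss ι)
    (F := fun n x => |f n x - p x|) (f := fun _ => 0) B
    (fun n => ((hf n).sub hp).norm) hB (fun n => by simpa using hfb n) (by
      filter_upwards [hlim] with x hx
      have := (hx.sub_const (p x)).abs
      simpa using this)
  simpa using this

/-- Smooth approximation of a bounded density that equals `1` outside of a ball. -/
lemma exists_isRegular_approx_of_bounded {p : (ι → ℝ) → ℝ}
    (hp : AEStronglyMeasurable p (volume : Measure (ι → ℝ))) {m K r : ℝ} (hm : 0 < m)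
    (hb : ∀ x, p x ∈ Set.Icc m K) (hr : ∀ x, r < ‖x‖ → p x = 1) {ε : ℝ} (hε : 0 < ε) :
    ∃ u g C, IsRegular u g m K C ∧ ∫ x, |u x - p x| ∂gauss ι < ε ∧
      ∫ x, klFun (u x) ∂gauss ι < ∫ x, klFun (p x) ∂gauss ι + ε := by
  -- Mollifying p - 1, which has compact support, and adding 1 back gives functions that are still
  -- constant outside a compact set.
  set q : (ι → ℝ) → ℝ := fun x => p x - 1 with hq
  have hqs : HasCompactSupport q := HasCompactSupport.intro (isCompact_closedBall 0 r) fun x hx => by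
    rw [mem_closedBall_zero_iff, not_le] at hx
    simp [hq, hr x hx]
  have hqb : ∀ x, q x ∈ Set.Icc (m - 1) (K - 1) := fun x =>
    ⟨sub_le_sub_right (hb x).1 1, sub_le_sub_right (hb x).2 1⟩
  have hqm : AEStronglyMeasurable q volume := hp.sub aestronglyMeasurable_const
  have hqi : LocallyIntegrable q volume := by
    refine (locallyIntegrable_const (|m - 1| + |K - 1|)).mono hqm (Eventually.of_forall fun x => ?_)
    rw [Real.norm_eq_abs, Real.norm_eq_abs, abs_of_nonneg (add_nonneg (abs_nonneg (m - 1)) (abs_nonneg _)), abs_le]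
    have := hqb x
    constructor
    · linarith [this.1, neg_abs_le (m - 1), abs_nonneg (K - 1)]
    · linarith [this.2, le_abs_self (K - 1), abs_nonneg (m - 1)]
  -- The outer radius is twice the inner one: a bounded ratio is what almost everywhere convergence
  -- of the mollification requires.
  let φ : ℕ → ContDiffBump (0 : ι → ℝ) := fun n =>
    { rIn := 1 / ((n : ℝ) + 1), rOut := 2 / ((n : ℝ) + 1), rIn_pos := by positivity,
      rIn_lt_rOut := by gcongr; norm_num }
  have hφ : Tendsto (fun n => (φ n).rOut) atTop (𝓝 0) := by
    have := (tendsto_one_div_add_atTop_nhds_zero_nat (𝕜 := ℝ)).const_mul 2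
    simpa [φ, div_eq_mul_inv] using this
  have hφ' : ∀ᶠ n in atTop, (φ n).rOut ≤ 2 * (φ n).rIn := Eventually.of_forall fun n => by
    simp only [φ]; rw [mul_one_div]
  have hae := ContDiffBump.ae_convolution_tendsto_right_of_locallyIntegrable hφ hφ' hqi
  set u : ℕ → (ι → ℝ) → ℝ := fun n x =>
    1 + ((φ n).normed volume ⋆[ContinuousLinearMap.lsmul ℝ ℝ, volume] q) x with hu
  have hsm : ∀ n, ContDiff ℝ 1 (u n) := fun n => contDiff_const.add
    ((φ n).hasCompactSupport_normed.contDiff_convolution_left _ (n := 1) (φ n).contDiff_normed hqi)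
  have hcs : ∀ n, HasCompactSupport fun x => u n x - 1 := fun n => by
    have := ((φ n).hasCompactSupport_normed (μ := volume)).convolution (μ := volume)
      (ContinuousLinearMap.lsmul ℝ ℝ) hqs
    have e : (fun x => u n x - 1)
        = ((φ n).normed volume ⋆[ContinuousLinearMap.lsmul ℝ ℝ, volume] q) := by
      funext x
      simp only [hu, add_sub_cancel_left]
    rw [e]
    exact this
  have hub : ∀ n x, u n x ∈ Set.Icc m K := by
    intro n x
    have hex : Integrable (fun t => (φ n).normed volume t * q (x - t)) volume :=
      (φ n).hasCompactSupport_normed.convolutionExists_left (ContinuousLinearMap.lsmul ℝ ℝ)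
        (φ n).continuous_normed hqi x
    have hφi : Integrable ((φ n).normed volume) volume := (φ n).integrable_normed
    have h1 : ∫ t, (φ n).normed volume t * (m - 1) ≤ ∫ t, (φ n).normed volume t * q (x - t) :=
      integral_mono (hφi.mul_const _) hex fun t =>
        mul_le_mul_of_nonneg_left (hqb _).1 ((φ n).nonneg_normed t)
    have h2 : ∫ t, (φ n).normed volume t * q (x - t) ≤ ∫ t, (φ n).normed volume t * (K - 1) :=
      integral_mono hex (hφi.mul_const _) fun t =>
        mul_le_mul_of_nonneg_left (hqb _).2 ((φ n).nonneg_normed t)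
    rw [integral_mul_const, (φ n).integral_normed, one_mul] at h1 h2
    have h3 : u n x = 1 + ∫ t, (φ n).normed volume t * q (x - t) := rfl
    rw [h3]
    exact ⟨by linarith, by linarith⟩
  have hlim : ∀ᵐ x ∂gauss ι, Tendsto (fun n => u n x) atTop (𝓝 (p x)) := by
    refine gauss_absolutelyContinuous.ae_le ?_
    filter_upwards [hae] with x hx
    have := hx.const_add 1
    simpa [hu, hq] using this
  have hum : ∀ n, AEStronglyMeasurable (u n) (gauss ι) := fun n =>
    (hsm n).continuous.aestronglyMeasurable
  have t1 := tendsto_integral_abs_sub_of_bounded (B := fun _ => K - m) hum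
    (hp.mono_ac gauss_absolutelyContinuous) (integrable_const _)
    (fun n => Eventually.of_forall fun x => by
      rw [abs_le]
      have h1 := hub n x
      have h2 := hb x
      exact ⟨by linarith [h1.1, h2.2], by linarith [h1.2, h2.1]⟩) hlim
  have t2 := tendsto_integral_klFun_of_bounded hum
    (fun n x => ⟨hm.le.trans (hub n x).1, (hub n x).2⟩) hlim
  obtain ⟨n, h1, h2⟩ := ((t1.eventually_lt_const hε).and
    (t2.eventually_lt_const (lt_add_of_pos_right _ hε))).exists
  obtain ⟨g, C, hg⟩ := exists_isRegular_of_contDiff (hsm n) (hcs n) hm (hub n)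
  exact ⟨u n, g, C, hg, h1, h2⟩

/-- Regular approximation of a density with finite entropy. -/
lemma exists_isRegular_approx {h : (ι → ℝ) → ℝ} (hi : Integrable h (gauss ι))
    (h0 : ∀ᵐ x ∂gauss ι, 0 ≤ h x) (hk : Integrable (fun x => klFun (h x)) (gauss ι)) {ε : ℝ}
    (hε : 0 < ε) : ∃ u g m K C, IsRegular u g m K C ∧ ∫ x, |u x - h x| ∂gauss ι < ε ∧
      ∫ x, klFun (u x) ∂gauss ι < ∫ x, klFun (h x) ∂gauss ι + ε := by
  classical
  let a : ℕ → ℝ := fun n => 1 / ((n : ℝ) + 1)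
  let b : ℕ → ℝ := fun n => (n : ℝ) + 1
  have ha : ∀ n, 0 < a n := fun n => by positivity
  have ha1 : ∀ n, a n ≤ 1 := fun n => by
    rw [div_le_one (by positivity)]; linarith [n.cast_nonneg (α := ℝ)]
  have hb1 : ∀ n, 1 ≤ b n := fun n => by simp [b]
  -- Clamping inside the ball and the value 1 outside both move h towards 1, so they never raise
  -- `klFun`. No convergence of entropies is needed at this stage.
  let p : ℕ → (ι → ℝ) → ℝ := fun n x => if ‖x‖ ≤ n then max (a n) (min (h x) (b n)) else 1
  have hpb : ∀ n x, p n x ∈ Set.Icc (a n) (b n) := by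
    intro n x
    simp only [p]
    split_ifs
    · exact ⟨le_max_left _ _, max_le ((ha1 n).trans (hb1 n)) (min_le_right _ _)⟩
    · exact ⟨ha1 n, hb1 n⟩
  have hhm : AEStronglyMeasurable h (volume : Measure (ι → ℝ)) :=
    hi.aestronglyMeasurable.mono_ac volume_absolutelyContinuous_gauss
  have hpm : ∀ n, AEStronglyMeasurable (p n) (volume : Measure (ι → ℝ)) := by
    intro n
    have h1 : AEStronglyMeasurable (fun x => max (a n) (min (h x) (b n)))
        (volume : Measure (ι → ℝ)) :=
      (show Continuous fun y : ℝ => max (a n) (min y (b n)) by fun_prop).comp_aestronglyMeasurable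
        hhm
    have hs : MeasurableSet {x : ι → ℝ | ‖x‖ ≤ n} := measurableSet_le (by fun_prop) measurable_const
    exact (h1.restrict.piecewise hs aestronglyMeasurable_const : AEStronglyMeasurable
      ({x : ι → ℝ | ‖x‖ ≤ n}.piecewise (fun x => max (a n) (min (h x) (b n))) fun _ => 1) volume)
  have hlim : ∀ᵐ x ∂gauss ι, Tendsto (fun n => p n x) atTop (𝓝 (h x)) := by
    filter_upwards [h0] with x hx
    have h1 : Tendsto (fun n => max (a n) (h x)) atTop (𝓝 (h x)) := by
      have := (tendsto_one_div_add_atTop_nhds_zero_nat (𝕜 := ℝ)).max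
        (tendsto_const_nhds (x := h x))
      rwa [max_eq_right hx] at this
    refine h1.congr' ?_
    obtain ⟨n₀, hn₀⟩ := exists_nat_ge (max ‖x‖ (h x))
    filter_upwards [eventually_ge_atTop n₀] with n hn
    have hn' : (n₀ : ℝ) ≤ n := by exact_mod_cast hn
    have hx1 : ‖x‖ ≤ n := (le_max_left _ _).trans (hn₀.trans hn')
    have hx2 : h x ≤ b n := ((le_max_right _ _).trans (hn₀.trans hn')).trans (by simp [b])
    simp only [p, hx1, if_true, min_eq_left hx2]
  have hkp : ∀ n, ∀ᵐ x ∂gauss ι, klFun (p n x) ≤ klFun (h x) := by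
    intro n
    filter_upwards [h0] with x hx
    simp only [p]
    split_ifs
    · exact klFun_clamp_le (ha1 n) (hb1 n) hx
    · rw [klFun_one]; exact klFun_nonneg hx
  have hdom : ∀ n, ∀ᵐ x ∂gauss ι, |p n x - h x| ≤ h x + 1 := by
    intro n
    filter_upwards [h0] with x hx
    have h1 := (hpb n x).1
    have h2 := ha n
    have h3 : p n x ≤ h x + 1 := by
      simp only [p]
      split_ifs
      · exact max_le (by linarith [ha1 n]) (by linarith [min_le_left (h x) (b n)])
      · linarith
    rw [abs_le]
    constructor <;> linarith
  have t1 := tendsto_integral_abs_sub_of_bounded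
    (fun n => (hpm n).mono_ac gauss_absolutelyContinuous) hi.aestronglyMeasurable
    (hi.add (integrable_const 1)) hdom hlim
  obtain ⟨n, hn⟩ := (t1.eventually_lt_const (half_pos hε)).exists
  obtain ⟨u, g, C, hu, hu1, hu2⟩ := exists_isRegular_approx_of_bounded (hpm n) (ha n) (hpb n)
    (r := n) (fun x hx => by simp only [p, not_le.2 hx, if_false]) (half_pos hε)
  have hpi : Integrable (p n) (gauss ι) :=
    Integrable.of_bound ((hpm n).mono_ac gauss_absolutelyContinuous) (b n)
      (Eventually.of_forall fun x => by
        rw [Real.norm_of_nonneg ((ha n).le.trans (hpb n x).1)]; exact (hpb n x).2)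
  refine ⟨u, g, a n, b n, C, hu, ?_, ?_⟩
  · have hui : Integrable u (gauss ι) := hu.integrable measurable_id
    calc ∫ x, |u x - h x| ∂gauss ι ≤ ∫ x, (|u x - p n x| + |p n x - h x|) ∂gauss ι :=
          integral_mono (hui.sub hi).abs ((hui.sub hpi).abs.add (hpi.sub hi).abs)
            fun x => abs_sub_le _ _ _
      _ = ∫ x, |u x - p n x| ∂gauss ι + ∫ x, |p n x - h x| ∂gauss ι :=
          integral_add (hui.sub hpi).abs (hpi.sub hi).abs
      _ < ε := by linarith
  · have : ∫ x, klFun (p n x) ∂gauss ι ≤ ∫ x, klFun (h x) ∂gauss ι :=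
      integral_mono_of_nonneg (Eventually.of_forall fun x =>
        klFun_nonneg ((ha n).le.trans (hpb n x).1)) hk (hkp n)
    linarith

end Approximation

/-! ### Lower semicontinuity, and the entropy as an integral of `klFun`. -/

section Limit

open Filter Topology InformationTheory

/-- Lower semicontinuity of the entropy under convergence in `L¹`. -/
lemma integral_klFun_le_of_tendsto {α : Type*} [MeasurableSpace α] {μ : Measure α}
    {p : α → ℝ} {f : ℕ → α → ℝ} {b : ℕ → ℝ} {B : ℝ}
    (hp : Integrable p μ) (hf : ∀ n, Integrable (f n) μ) (hf0 : ∀ n x, 0 ≤ f n x)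
    (hlim : Tendsto (fun n => ∫ x, |f n x - p x| ∂μ) atTop (𝓝 0))
    (hfk : ∀ n, Integrable (fun x => klFun (f n x)) μ)
    (hb : ∀ n, ∫ x, klFun (f n x) ∂μ ≤ b n) (hB : Tendsto b atTop (𝓝 B)) :
    (∀ᵐ x ∂μ, 0 ≤ p x) ∧ Integrable (fun x => klFun (p x)) μ ∧ ∫ x, klFun (p x) ∂μ ≤ B := by
  -- Convergence in L¹ gives almost everywhere convergence along a subsequence. Since `klFun` is
  -- nonnegative, unlike x log x, Fatou's lemma then applies.
  have h1 : Tendsto (fun n => eLpNorm (f n - p) 1 μ) atTop (𝓝 0) := by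
    have e : ∀ n, eLpNorm (f n - p) 1 μ = ENNReal.ofReal (∫ x, |f n x - p x| ∂μ) := fun n => by
      rw [eLpNorm_one_eq_lintegral_enorm,
        ← ofReal_integral_norm_eq_lintegral_enorm ((hf n).sub hp)]
      rfl
    simp only [e]
    have h := (ENNReal.continuous_ofReal.tendsto 0).comp hlim
    rwa [ENNReal.ofReal_zero] at h
  obtain ⟨ns, hns, hae⟩ := (tendstoInMeasure_of_tendsto_eLpNorm one_ne_zero
    (fun n => (hf n).aestronglyMeasurable) hp.aestronglyMeasurable h1).exists_seq_tendsto_ae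
  have hp0 : ∀ᵐ x ∂μ, 0 ≤ p x := by
    filter_upwards [hae] with x hx
    exact ge_of_tendsto' hx fun n => hf0 _ x
  have hk : ∫⁻ x, ENNReal.ofReal (klFun (p x)) ∂μ ≤ ENNReal.ofReal B := by
    calc ∫⁻ x, ENNReal.ofReal (klFun (p x)) ∂μ
        = ∫⁻ x, liminf (fun n => ENNReal.ofReal (klFun (f (ns n) x))) atTop ∂μ := by
          refine lintegral_congr_ae ?_
          filter_upwards [hae] with x hx
          exact (((ENNReal.continuous_ofReal.comp continuous_klFun).tendsto _).comp hx).liminf_eq.symm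
      _ ≤ liminf (fun n => ∫⁻ x, ENNReal.ofReal (klFun (f (ns n) x)) ∂μ) atTop :=
          lintegral_liminf_le' fun n => (hfk _).aestronglyMeasurable.aemeasurable.ennreal_ofReal
      _ ≤ liminf (fun n => ENNReal.ofReal (b (ns n))) atTop := by
          refine liminf_le_liminf (Eventually.of_forall fun n => ?_)
          rw [← ofReal_integral_eq_lintegral_ofReal (hfk _)
            (Eventually.of_forall fun x => klFun_nonneg (hf0 _ x))]
          exact ENNReal.ofReal_le_ofReal (hb _)
      _ = ENNReal.ofReal B :=
          (((ENNReal.continuous_ofReal.tendsto B).comp hB).comp hns.tendsto_atTop).liminf_eq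
  have hB0 : 0 ≤ B := ge_of_tendsto' hB fun n =>
    (integral_nonneg fun x => klFun_nonneg (hf0 n x)).trans (hb n)
  have hk0 : 0 ≤ᵐ[μ] fun x => klFun (p x) := by
    filter_upwards [hp0] with x hx using klFun_nonneg hx
  have hm : AEStronglyMeasurable (fun x => klFun (p x)) μ :=
    continuous_klFun.comp_aestronglyMeasurable hp.aestronglyMeasurable
  refine ⟨hp0, ⟨hm, ?_⟩, ?_⟩
  · rw [hasFiniteIntegral_iff_ofReal hk0]
    exact hk.trans_lt ENNReal.ofReal_lt_top
  · rw [integral_eq_lintegral_of_nonneg_ae hk0 hm]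
    exact ENNReal.toReal_le_of_le_ofReal hB0 hk

variable {M : ℕ} {f : (Fin M → ℝ) → ℝ}

lemma maxwellian_pos (v : Fin M → ℝ) : 0 < maxwellian v := Real.exp_pos _

/-- The correction f - γ is integrable when f is and has integral zero for a probability density, so
the relative entropy is the integral of the nonnegative function `klFun`. -/
lemma mul_log_div_maxwellian (v : Fin M → ℝ) : f v * Real.log (f v / maxwellian v)
    = gaussDensity v * klFun (f v / maxwellian v) + (f v - gaussDensity v) := by
  have h := (maxwellian_pos v).ne'
  change _ = maxwellian v * _ + (_ - maxwellian v)
  rw [klFun_apply]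
  field_simp
  ring

lemma integral_gauss_div_maxwellian : ∫ v, f v / maxwellian v ∂gauss (Fin M) = ∫ v, f v := by
  rw [integral_gauss]
  exact integral_congr_ae (Eventually.of_forall fun v => mul_div_cancel₀ _ (maxwellian_pos v).ne')

lemma integrable_gauss_div_maxwellian (hf : Integrable f) :
    Integrable (fun v => f v / maxwellian v) (gauss (Fin M)) := by
  rw [integrable_gauss_iff]
  refine hf.congr (Eventually.of_forall fun v => ?_)
  exact (mul_div_cancel₀ _ (maxwellian_pos v).ne').symm

lemma integrable_mul_log_iff (hf : Integrable f) :
    Integrable (fun v => f v * Real.log (f v / maxwellian v)) ↔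
      Integrable (fun v => klFun (f v / maxwellian v)) (gauss (Fin M)) := by
  rw [integrable_gauss_iff]
  simp only [mul_log_div_maxwellian]
  exact integrable_add_iff_integrable_left (hf.sub integrable_gaussDensity)

lemma relEntropy_eq (hf : Integrable f) (hf1 : ∫ v, f v = 1)
    (hk : Integrable (fun v => klFun (f v / maxwellian v)) (gauss (Fin M))) :
    relEntropy f = ((∫ v, klFun (f v / maxwellian v) ∂gauss (Fin M) : ℝ) : EReal) := by
  rw [relEntropy, if_pos ((integrable_mul_log_iff hf).2 hk)]
  simp only [mul_log_div_maxwellian]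
  have hs : Integrable fun v => f v - gaussDensity v := hf.sub integrable_gaussDensity
  rw [integral_add ((integrable_gauss_iff _).1 hk) hs, integral_sub hf integrable_gaussDensity, hf1, integral_gaussDensity, sub_self, add_zero,
    integral_gauss]

end Limit

/-! ### Marginals of L¹ states and of rotation averages. -/

section Marginal

variable {M N : ℕ}

lemma measurePreserving_sumElim_volume :
    MeasurePreserving (fun p : (Fin M → ℝ) × (Fin N → ℝ) => (Sum.elim p.1 p.2 : Particle M N → ℝ))
      (volume.prod volume) volume := by
  have hm : (fun p : (Fin M → ℝ) × (Fin N → ℝ) => (Sum.elim p.1 p.2 : Particle M N → ℝ))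
      = (MeasurableEquiv.sumPiEquivProdPi (fun _ : Particle M N => ℝ)).symm := by
    funext p k; cases k <;> rfl
  rw [hm]
  exact volume_measurePreserving_sumPiEquivProdPi_symm (fun _ : Particle M N => ℝ)

lemma integrable_comp_sumElim {F : (Particle M N → ℝ) → ℝ} (hF : Integrable F) :
    Integrable (fun p : (Fin M → ℝ) × (Fin N → ℝ) => F (Sum.elim p.1 p.2))
      (volume.prod volume) :=
  measurePreserving_sumElim_volume.integrable_comp_of_integrable hF

lemma integrable_marginal (F : State M N) : Integrable (marginal F) :=
  (integrable_comp_sumElim (L1.integrable_coeFn F)).integral_prod_left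

lemma marginal_ae_eq {F : State M N} {G : (Particle M N → ℝ) → ℝ} (h : F =ᵐ[volume] G) :
    marginal F =ᵐ[volume] fun v => ∫ w : Fin N → ℝ, G (Sum.elim v w) := by
  have h1 := measurePreserving_sumElim_volume.quasiMeasurePreserving.ae h
  filter_upwards [Measure.ae_ae_of_ae_prod h1] with v hv
  exact integral_congr_ae hv

/-- Integrating out the reservoir is an L¹ contraction, which transfers convergence of states to
their marginals. -/
lemma integral_abs_marginal_sub_le (F G : State M N) :
    ∫ v, |marginal F v - marginal G v| ≤ ‖F - G‖ := by
  have hF := integrable_comp_sumElim (L1.integrable_coeFn F)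
  have hG := integrable_comp_sumElim (L1.integrable_coeFn G)
  have hFG := integrable_comp_sumElim (L1.integrable_coeFn (F - G))
  have h1 : (fun v => |marginal F v - marginal G v|) =ᵐ[volume] fun v => |marginal (F - G) v| := by
    filter_upwards [marginal_ae_eq (Lp.coeFn_sub F G), hF.prod_right_ae, hG.prod_right_ae]
      with v h h2 h3
    rw [h]
    congr 1
    exact (integral_sub h2 h3).symm
  rw [integral_congr_ae h1, L1.norm_eq_integral_norm]
  calc ∫ v, |marginal (F - G) v|
      ≤ ∫ v : Fin M → ℝ, ∫ w : Fin N → ℝ, ‖(F - G) (Sum.elim v w)‖ :=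
        integral_mono (integrable_marginal _).norm hFG.norm.integral_prod_left
          fun v => norm_integral_le_integral_norm (fun w => (F - G) (Sum.elim v w))
    _ = ∫ p : (Fin M → ℝ) × (Fin N → ℝ), ‖(F - G) (Sum.elim p.1 p.2)‖ ∂volume.prod volume :=
        (integral_prod _ hFG.norm).symm
    _ = ∫ x, ‖(F - G) x‖ := integral_comp_measurePreserving measurePreserving_sumElim_volume
        (g := fun x => ‖(F - G) x‖) (L1.integrable_coeFn _).aestronglyMeasurable.norm

lemma norm_initialState_sub {f f' : (Fin M → ℝ) → ℝ} (hf : Integrable f) (hf' : Integrable f') :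
    ‖initialState N f hf - initialState N f' hf'‖ = ∫ v, |f v - f' v| := by
  have hi : Integrable fun v => f v - f' v := hf.sub hf'
  have hs : initialState N f hf - initialState N f' hf'
      = initialState N (fun v => f v - f' v) hi := by
    rw [initialState, initialState, ← Integrable.toL1_sub]
    refine (Integrable.toL1_eq_toL1_iff _ _ _ _).2 (Filter.Eventually.of_forall fun x => ?_)
    simp only [initialFun, Pi.sub_apply]
    ring
  rw [hs, initialState, L1.norm_of_fun_eq_integral_norm,
    ← integral_comp_measurePreserving measurePreserving_sumElim_volume
      (integrable_initialFun N hi).aestronglyMeasurable.norm,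
    integral_prod _ (integrable_comp_sumElim (integrable_initialFun N hi)).norm]
  refine integral_congr_ae (Filter.Eventually.of_forall fun v => ?_)
  have h1 : ∀ w : Fin N → ℝ, ‖initialFun (fun v => f v - f' v) (Sum.elim v w)‖
      = |f v - f' v| * gaussDensity w := fun w => by
    rw [initialFun, norm_mul, Real.norm_eq_abs, Real.norm_of_nonneg (maxwellian_pos _).le]
    rfl
  simp only [h1]
  rw [integral_const_mul, integral_gaussDensity, mul_one]

/-- The marginal after an average over rotations of the initial state with density `u`
relative to the Maxwellian. -/
lemma marginal_average_ae_eq {Ω : Type*} [MeasurableSpace Ω] (P : Measure Ω)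
    [IsProbabilityMeasure P] {R : Ω → Matrix (Particle M N) (Particle M N) ℝ}
    (hRm : ∀ k l, Measurable fun ω => R ω k l) (hR : ∀ ω, (R ω).transpose * R ω = 1)
    {u : (Fin M → ℝ) → ℝ} {g : Fin M → (Fin M → ℝ) → ℝ} {m K C : ℝ} (H : IsRegular u g m K C)
    (hu : Integrable fun v => maxwellian v * u v) {F : State M N}
    (hF : F =ᵐ[volume] fun x => ∫ ω,
      initialState N (fun v => maxwellian v * u v) hu ((R ω).mulVec x) ∂P) :
    marginal F =ᵐ[volume] fun v => maxwellian v * systemAverage P R u v := by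
  have h1 : F =ᵐ[volume] fun x => gaussDensity x *
      ∫ ω, u (fun i => (R ω).mulVec x (Sum.inl i)) ∂P := by
    filter_upwards [hF, ae_ae_mulVec P hRm hR (Integrable.coeFn_toL1
      (integrable_initialFun N hu))] with x hx h
    rw [hx, ← integral_const_mul]
    refine integral_congr_ae ?_
    filter_upwards [h] with ω hω
    rw [initialState, hω]
    -- The full Gaussian at x equals the one at R x, which splits into system and reservoir
    -- Maxwellians; the rotated initial state is thus the unrotated Gaussian times u at the system
    -- part.
    have h2 : gaussDensity x = maxwellian (fun i => (R ω).mulVec x (Sum.inl i)) *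
        maxwellian (fun j => (R ω).mulVec x (Sum.inr j)) := by
      have h3 := gaussDensity_elim (fun i => (R ω).mulVec x (Sum.inl i))
        (fun j => (R ω).mulVec x (Sum.inr j))
      have h4 : gaussDensity ((R ω).mulVec x) = gaussDensity x := by
        simp only [gaussDensity, sum_sq_mulVec_of_orthogonal (hR ω)]
      rw [← h4]
      refine Eq.trans (congrArg gaussDensity ?_) h3
      funext k; cases k <;> rfl
    rw [h2, initialFun]
    ring
  refine (marginal_ae_eq h1).trans (Filter.Eventually.of_forall fun v => ?_)
  have h5 : Integrable (fun p : Ω × (Fin N → ℝ) => u (systemPart (R p.1) v p.2))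
      (P.prod (gauss (Fin N))) :=
    H.integrable (measurable_systemPart hRm measurable_fst measurable_const measurable_snd)
  change ∫ w : Fin N → ℝ, _ = maxwellian v * ∫ p : Ω × (Fin N → ℝ), _ ∂_
  rw [integral_prod_symm _ h5, integral_gauss, ← integral_const_mul]
  refine integral_congr_ae (Filter.Eventually.of_forall fun w => ?_)
  simp only [gaussDensity_elim, mul_assoc]
  rfl

end Marginal

/-! ### Entropy contraction along the Kac evolution. -/

section Evolution

open Filter Topology InformationTheory

lemma IsRegular.integral_klFun {ι : Type*} [Fintype ι] {h : (ι → ℝ) → ℝ}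
    {g : ι → (ι → ℝ) → ℝ} {m K C : ℝ} (H : IsRegular h g m K C) :
    Integrable (fun x => klFun (h x)) (gauss ι) ∧ ∫ x, klFun (h x) ∂gauss ι
      = ∫ x, h x * Real.log (h x) ∂gauss ι + 1 - ∫ x, h x ∂gauss ι := by
  have h1 : Integrable h (gauss ι) := H.integrable measurable_id
  have hk : Integrable (fun x => klFun (h x)) (gauss ι) :=
    integrable_of_bounded (C := 1 + klFun K) (measurable_klFun.comp H.measurable) fun x => by
      rw [abs_of_nonneg (klFun_nonneg (H.pos_apply x).le)]
      exact klFun_le_of_mem_Icc ⟨(H.pos_apply x).le, H.upper x⟩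
  refine ⟨hk, ?_⟩
  have h2 : ∀ x, h x * Real.log (h x) = klFun (h x) + (h x - 1) := fun x => by
    rw [klFun_apply]; ring
  have hs : Integrable (fun x => h x - 1) (gauss ι) := h1.sub (integrable_const 1)
  simp only [h2]
  rw [integral_add hk hs, integral_sub h1 (integrable_const 1)]
  simp only [integral_const, probReal_univ, smul_eq_mul, mul_one]
  ring

variable {M N : ℕ}

/-- The projection onto the system is D + M/(N+M) I, and conjugation by R fixes the identity. This
turns knowledge of R D Rᵀ into knowledge of A Aᵀ. -/
lemma sum_excess (hM : 1 ≤ M) {R : Matrix (Particle M N) (Particle M N) ℝ}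
    (hR : R.transpose * R = 1) (k k' : Fin M) :
    ∑ l, R (Sum.inl k) (Sum.inl l) * R (Sum.inl k') (Sum.inl l)
      = ∑ m, R (Sum.inl k) m * excess M N m * R (Sum.inl k') m
        + (M : ℝ) / (N + M) * if k = k' then 1 else 0 := by
  have h1 : ∑ m, R (Sum.inl k) m * R (Sum.inl k') m = if k = k' then 1 else 0 := by
    have h0 : R * R.transpose = 1 := mul_eq_one_comm.1 hR
    have h2 := congrFun (congrFun h0 (Sum.inl k)) (Sum.inl k')
    simpa [Matrix.mul_apply, Matrix.one_apply] using h2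
  have hM' : (0 : ℝ) < M := by exact_mod_cast hM
  have hc : (N : ℝ) / (N + M) = 1 - M / (N + M) := by field_simp; ring
  rw [← h1, Finset.mul_sum, ← Finset.sum_add_distrib, Fintype.sum_sum_type]
  simp only [excess, Sum.elim_inl, Sum.elim_inr, hc]
  rw [Finset.sum_congr rfl fun l (_ : l ∈ Finset.univ) => show
    R (Sum.inl k) (Sum.inl l) * (1 - (M : ℝ) / (N + M)) * R (Sum.inl k') (Sum.inl l)
      + M / (N + M) * (R (Sum.inl k) (Sum.inl l) * R (Sum.inl k') (Sum.inl l))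
      = R (Sum.inl k) (Sum.inl l) * R (Sum.inl k') (Sum.inl l) by ring,
    Finset.sum_eq_zero fun l (_ : l ∈ Finset.univ) => show
    R (Sum.inl k) (Sum.inr l) * -((M : ℝ) / (N + M)) * R (Sum.inl k') (Sum.inr l)
      + M / (N + M) * (R (Sum.inl k) (Sum.inr l) * R (Sum.inl k') (Sum.inr l)) = 0 by ring,
    add_zero]

/-- Entropy contraction for the marginal of an average over rotations. -/
lemma IsRotationAverage.exists_isRegular_marginal (hM : 1 ≤ M) {q : ℝ}
    {K : State M N →L[ℝ] State M N} (hK : IsRotationAverage (excess M N) q K)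
    {u : (Fin M → ℝ) → ℝ} {g : Fin M → (Fin M → ℝ) → ℝ} {m B C : ℝ} (H : IsRegular u g m B C)
    (hu : Integrable fun v => maxwellian v * u v) :
    ∃ f g' m' B' C', IsRegular f g' m' B' C' ∧
      marginal (K (initialState N (fun v => maxwellian v * u v) hu))
        =ᵐ[volume] (fun v => maxwellian v * f v) ∧
      ∫ v, f v ∂gauss (Fin M) = ∫ v, u v ∂gauss (Fin M) ∧
      ∫ v, klFun (f v) ∂gauss (Fin M) ≤ ((M : ℝ) / (N + M) + N / (N + M) * q) *
        (∫ v, klFun (u v) ∂gauss (Fin M) - klFun (∫ v, u v ∂gauss (Fin M)))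
          + klFun (∫ v, u v ∂gauss (Fin M)) := by
  obtain ⟨Ω, _, P, _, R, hRm, hR, hc, hKR⟩ := hK
  have HF := H.systemAverage (P := P) hRm hR
  refine ⟨_, _, _, _, _, HF, marginal_average_ae_eq P hRm hR H hu (hKR _),
    integral_systemAverage H hRm hR, ?_⟩
  have hb : ∀ ω k l, |R ω k l| ≤ 1 := fun ω => abs_entry_le_one_of_orthogonal (hR ω)
  have ha : ∀ k k' : Fin M,
      ∫ ω, ∑ l, R ω (Sum.inl k) (Sum.inl l) * R ω (Sum.inl k') (Sum.inl l) ∂P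
        = if k = k' then (M : ℝ) / (N + M) + N / (N + M) * q else 0 := fun k k' => by
    have hi : Integrable (fun ω => ∑ m, R ω (Sum.inl k) m * excess M N m * R ω (Sum.inl k') m) P :=
      integrable_finsetSum _ fun l _ =>
        integrable_of_bounded (C := |excess M N l|) (((hRm _ _).mul_const _).mul (hRm _ _))
          fun ω => abs_mul_mul_le (hb _ _ _) (hb _ _ _)
    rw [integral_congr_ae (Eventually.of_forall fun ω => sum_excess hM (hR ω) k k'),
      integral_add hi (integrable_const _), hc]
    rcases eq_or_ne k k' with rfl | hkk
    · simp [excess]; ring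
    · simp [hkk]
  have h1 := H.entropy_systemAverage_le (P := P) hRm hR ha
  -- The mass of u need not be 1. The gap ∫ `klFun`(u) - `klFun`(∫ u) equals ∫ u log u - (∫ u) log ∫
  -- u, the quantity that is contracted.
  rw [HF.integral_klFun.2, H.integral_klFun.2, integral_systemAverage H hRm hR, klFun_apply]
  set a : ℝ := (M : ℝ) / (N + M) + N / (N + M) * q
  linarith

lemma tendsto_integral_of_tendsto_integral_abs_sub {α : Type*} [MeasurableSpace α] {μ : Measure α}
    {f : ℕ → α → ℝ} {p : α → ℝ} (hf : ∀ n, Integrable (f n) μ) (hp : Integrable p μ)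
    (h : Tendsto (fun n => ∫ x, |f n x - p x| ∂μ) atTop (𝓝 0)) :
    Tendsto (fun n => ∫ x, f n x ∂μ) atTop (𝓝 (∫ x, p x ∂μ)) := by
  rw [tendsto_iff_norm_sub_tendsto_zero]
  refine squeeze_zero (fun _ => norm_nonneg _) (fun n => ?_) h
  rw [← integral_sub (hf n) hp]
  exact norm_integral_le_integral_norm _

lemma integral_gauss_abs_sub_div_maxwellian (u f : (Fin M → ℝ) → ℝ) :
    ∫ v, |u v - f v / maxwellian v| ∂gauss (Fin M) = ∫ v, |maxwellian v * u v - f v| := by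
  rw [integral_gauss]
  refine integral_congr_ae (Eventually.of_forall fun v => ?_)
  have h := maxwellian_pos v
  change maxwellian v * _ = |_|
  rw [← abs_of_pos h, ← abs_mul, abs_of_pos h, mul_sub, mul_div_cancel₀ _ h.ne']

lemma tendsto_evolution (lamS lamR mu : ℝ) (ν : Measure ℝ) [IsProbabilityMeasure ν] (t : ℝ) :
    Tendsto (fun n : ℕ => (1 + (t / n) • generator M N lamS lamR mu ν) ^ n) atTop
      (𝓝 (evolution M N lamS lamR mu ν t)) := by
  have h := tendsto_one_add_inv_smul_pow_exp
    (ContinuousLinearMap.norm_id_le : ‖(1 : State M N →L[ℝ] State M N)‖ ≤ 1)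
    (t • generator M N lamS lamR mu ν)
  refine h.congr fun n => ?_
  rw [smul_smul, inv_mul_eq_div]

/-- Entropy contraction along the Kac evolution, in terms of densities relative to the
Maxwellian. -/
theorem integral_klFun_marginal_evolution_le (hM : 1 ≤ M) (hN : 1 ≤ N)
    {lamS lamR mu : ℝ} (hlamS : 0 ≤ lamS) (hlamR : 0 ≤ lamR) (hmu : 0 ≤ mu)
    (ν : Measure ℝ) [IsProbabilityMeasure ν] (hν : ∫ θ, Real.sin θ * Real.cos θ ∂ν = 0)
    {f₀ : (Fin M → ℝ) → ℝ} (hf₀ : Integrable f₀) (hpos : ∀ᵐ v, 0 ≤ f₀ v)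
    (hmass : ∫ v, f₀ v = 1) {t : ℝ} (ht : 0 ≤ t)
    (hk : Integrable (fun v => klFun (f₀ v / maxwellian v)) (gauss (Fin M)))
    {f : (Fin M → ℝ) → ℝ}
    (hf : f = marginal (evolution M N lamS lamR mu ν t (initialState N f₀ hf₀))) :
    Integrable f ∧ ∫ v, f v = 1 ∧
      Integrable (fun v => klFun (f v / maxwellian v)) (gauss (Fin M)) ∧
      ∫ v, klFun (f v / maxwellian v) ∂gauss (Fin M) ≤
        ((M : ℝ) / (N + M) + (N : ℝ) / (N + M) *
          Real.exp (-t * (mu * ∫ θ, Real.sin θ ^ 2 ∂ν) * (N + M) / N)) *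
        ∫ v, klFun (f₀ v / maxwellian v) ∂gauss (Fin M) := by
  set E := evolution M N lamS lamR mu ν t
  set S := ∑ a, pairRate M N lamS lamR mu a
  set κ := mu * (∫ θ, Real.sin θ ^ 2 ∂ν) * (N + M) / N with hκ
  set J := ∫ v, klFun (f₀ v / maxwellian v) ∂gauss (Fin M)
  have hfi : Integrable f := hf ▸ integrable_marginal _
  have hp0 : ∀ᵐ v ∂gauss (Fin M), 0 ≤ f₀ v / maxwellian v := by
    filter_upwards [gauss_absolutelyContinuous.ae_le hpos] with v hv
    exact div_nonneg hv (maxwellian_pos v).le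
  have hh := integrable_gauss_div_maxwellian hf₀
  choose u g m B C H hu1 hu2 using fun n : ℕ =>
    exists_isRegular_approx hh hp0 hk (Nat.one_div_pos_of_nat (α := ℝ) (n := n))
  have hui : ∀ n, Integrable fun v => maxwellian v * u n v := fun n =>
    (integrable_gauss_iff _).1 ((H n).integrable measurable_id)
  have hε := tendsto_one_div_add_atTop_nhds_zero_nat (𝕜 := ℝ)
  have hu0 : Tendsto (fun n => ∫ v, |u n v - f₀ v / maxwellian v| ∂gauss (Fin M)) atTop (𝓝 0) :=
    squeeze_zero (fun n => integral_nonneg fun _ => abs_nonneg _) (fun n => (hu1 n).le) hε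
  have hum : Tendsto (fun n => ∫ v, u n v ∂gauss (Fin M)) atTop (𝓝 1) := by
    have := tendsto_integral_of_tendsto_integral_abs_sub
      (fun n => (H n).integrable measurable_id) hh hu0
    rwa [integral_gauss_div_maxwellian, hmass] at this
  obtain ⟨n₀, hn₀⟩ := exists_nat_ge (max 1 (max (t * S) (t * κ)))
  -- Starting at n₀ guarantees that each step is a convex combination (tS ≤ n), that 1 - tκ/n is
  -- nonnegative, and that n is positive.
  have hs : Tendsto (fun n : ℕ => n + n₀) atTop atTop := tendsto_add_atTop_nat n₀
  have hs1 : ∀ n : ℕ, max 1 (max (t * S) (t * κ)) ≤ ((n + n₀ : ℕ) : ℝ) := fun n =>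
    hn₀.trans (by exact_mod_cast Nat.le_add_left _ _)
  have hspos : ∀ n : ℕ, (0 : ℝ) < ((n + n₀ : ℕ) : ℝ) := fun n =>
    zero_lt_one.trans_le ((le_max_left _ _).trans (hs1 n))
  have hK : ∀ n : ℕ, IsRotationAverage (excess M N) ((1 - t / (n + n₀ : ℕ) * κ) ^ (n + n₀))
      ((1 + (t / (n + n₀ : ℕ)) • generator M N lamS lamR mu ν) ^ (n + n₀)) := fun n =>
    (isRotationAverage_generator_step M N lamS lamR mu ν hM hN hlamS hlamR hmu hν
      (div_nonneg ht (hspos n).le) (by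
        rw [div_mul_eq_mul_div, div_le_one (hspos n)]
        exact ((le_max_left _ _).trans (le_max_right _ _)).trans (hs1 n))).pow _
  have hq0 : ∀ n : ℕ, 0 ≤ 1 - t / (n + n₀ : ℕ) * κ := fun n => by
    rw [sub_nonneg, div_mul_eq_mul_div, div_le_one (hspos n)]
    exact ((le_max_right _ _).trans (le_max_right _ _)).trans (hs1 n)
  choose fn g' m' B' C' Hn hfn hmn hkn using fun n =>
    (hK n).exists_isRegular_marginal hM (H n) (hui n)
  have hKlim : Tendsto (fun n : ℕ => (1 + (t / (n + n₀ : ℕ)) • generator M N lamS lamR mu ν) ^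
      (n + n₀)) atTop (𝓝 E) := (tendsto_evolution lamS lamR mu ν t (M := M) (N := N)).comp hs
  have hFlim : Tendsto (fun n => initialState N (fun v => maxwellian v * u n v) (hui n)) atTop
      (𝓝 (initialState N f₀ hf₀)) := by
    rw [tendsto_iff_norm_sub_tendsto_zero]
    simpa only [norm_initialState_sub, integral_gauss_abs_sub_div_maxwellian] using hu0
  -- The approximation of the exponential and that of the initial state are taken along the same
  -- index; joint continuity of evaluation suffices.
  have hKF : Tendsto (fun n : ℕ => ((1 + (t / (n + n₀ : ℕ)) • generator M N lamS lamR mu ν) ^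
      (n + n₀)) (initialState N (fun v => maxwellian v * u n v) (hui n))) atTop
      (𝓝 (E (initialState N f₀ hf₀))) :=
    (isBoundedBilinearMap_apply.continuous.tendsto (E, initialState N f₀ hf₀)).comp
      (hKlim.prodMk_nhds hFlim)
  have hlim : Tendsto (fun n => ∫ v, |fn n v - f v / maxwellian v| ∂gauss (Fin M)) atTop
      (𝓝 0) := by
    refine squeeze_zero (fun n => integral_nonneg fun _ => abs_nonneg _) (fun n => ?_)
      (tendsto_iff_norm_sub_tendsto_zero.1 hKF)
    rw [integral_gauss_abs_sub_div_maxwellian, hf]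
    refine (integral_congr_ae ?_).trans_le (integral_abs_marginal_sub_le _ _)
    filter_upwards [hfn n] with v hv
    rw [← hv]
  have hq : Tendsto (fun n : ℕ => (1 - t / (n + n₀ : ℕ) * κ) ^ (n + n₀)) atTop
      (𝓝 (Real.exp (-t * (mu * ∫ θ, Real.sin θ ^ 2 ∂ν) * (N + M) / N))) := by
    have h := (Real.tendsto_one_add_div_pow_exp (-t * κ)).comp hs
    have e : -t * (mu * ∫ θ, Real.sin θ ^ 2 ∂ν) * (N + M) / N = -t * κ := by rw [hκ]; ring
    rw [e]
    refine h.congr fun n => ?_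
    simp only [Function.comp_apply]
    congr 1
    ring
  have hkm : Tendsto (fun n => klFun (∫ v, u n v ∂gauss (Fin M))) atTop (𝓝 0) := by
    have := (continuous_klFun.tendsto 1).comp hum
    rwa [klFun_one] at this
  have hfpi := integrable_gauss_div_maxwellian hfi
  have hfni : ∀ n, Integrable (fn n) (gauss (Fin M)) := fun n => (Hn n).integrable measurable_id
  -- The mass corrections `klFun`(∫ u) vanish because the masses tend to 1 and `klFun` is zero
  -- there.
  have hb := ((((hq.const_mul ((N : ℝ) / (N + M))).const_add ((M : ℝ) / (N + M))).mul
    ((hε.const_add J).sub hkm)).add hkm)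
  rw [add_zero, sub_zero, add_zero] at hb
  obtain ⟨-, hk1, hk2⟩ := integral_klFun_le_of_tendsto hfpi hfni
    (fun n v => ((Hn n).pos_apply v).le) hlim (fun n => (Hn n).integral_klFun.1) (fun n => by
      refine (hkn n).trans (add_le_add_left (mul_le_mul_of_nonneg_left
        (sub_le_sub_right (hu2 n).le _) ?_) _)
      have := pow_nonneg (hq0 n) (n + n₀)
      positivity) hb
  refine ⟨hfi, ?_, hk1, hk2⟩
  have h1 := tendsto_integral_of_tendsto_integral_abs_sub hfni hfpi hlim
  rw [integral_gauss_div_maxwellian] at h1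
  exact tendsto_nhds_unique h1 (by simpa only [hmn] using hum)

end Evolution

end Kac

end

/-! ### The theorem for entropies with values in the extended reals. -/

theorem mainTheorem2 (M N : ℕ) (hM : 1 ≤ M) (hN : 1 ≤ N)
    (lamS lamR mu : ℝ) (hlamS : 0 ≤ lamS) (hlamR : 0 ≤ lamR) (hmu : 0 ≤ mu)
    (ν : MeasureTheory.Measure ℝ) [MeasureTheory.IsProbabilityMeasure ν]
    (hsupp : ν (Set.Icc (-Real.pi) Real.pi)ᶜ = 0)
    (hν : ∫ θ, Real.sin θ * Real.cos θ ∂ν = 0)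
    (f₀ : (Fin M → ℝ) → ℝ) (hf₀ : MeasureTheory.Integrable f₀)
    (hpos : ∀ᵐ v, 0 ≤ f₀ v) (hmass : ∫ v, f₀ v = 1)
    (t : ℝ) (ht : 0 ≤ t) :
    Kac.relEntropy
        (Kac.marginal (Kac.evolution M N lamS lamR mu ν t (Kac.initialState N f₀ hf₀))) ≤
      (((M : ℝ) / (N + M) + (N : ℝ) / (N + M) *
          Real.exp (-t * (mu * ∫ θ, Real.sin θ ^ 2 ∂ν) * (N + M) / N) : ℝ) : EReal) *
        Kac.relEntropy f₀ := by
  by_cases hi : Integrable fun v => f₀ v * Real.log (f₀ v / Kac.maxwellian v)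
  · have hk := (Kac.integrable_mul_log_iff hf₀).1 hi
    obtain ⟨hf, hf1, hkf, hle⟩ := Kac.integral_klFun_marginal_evolution_le hM hN hlamS hlamR
      hmu ν hν hf₀ hpos hmass ht hk rfl
    rw [Kac.relEntropy_eq hf hf1 hkf, Kac.relEntropy_eq hf₀ hmass hk, ← EReal.coe_mul,
      EReal.coe_le_coe_iff]
    exact hle
  · have hM' : (0 : ℝ) < M := by exact_mod_cast hM
    -- The prefactor must be strictly positive, since 0 times ⊤ is 0 in `EReal`; M ≥ 1 makes it so.
    rw [show Kac.relEntropy f₀ = ⊤ from if_neg hi, EReal.coe_mul_top_of_pos (by positivity)]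
    exact le_top
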